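/- Let $\gamma>0$, $\mu>0$, $\omega_0:=\frac{4}{\gamma^2}$, $\omega^*:=\frac{4}{\gamma^2}\,\frac{\mu+1}{\mu}$, and let $\omega>\omega_0$. Let $H_\gamma$ be the operator in $L^2(\mathbb R)$ (complex-valued functions) with domain $$D(H_\gamma)=\{\psi\in H^2(\mathbb R\setminus\{0\}) : \psi'(0+)=\psi'(0-),\ \psi(0+)-\psi(0-)=-\gamma\,\psi'(0+)\}$$ and action $H_\gamma\psi=-\psi''$ on $\mathbb R\setminus\{0\}$. Let $$y=\frac{1}{2\mu\sqrt\omega}\log\frac{\gamma\sqrt\omega+2}{\gamma\sqrt\omega-2}$$ (equivalently $\tanh(\mu\sqrt\omega\,y)=\frac{2}{\gamma\sqrt\omega}$), and let $$L_1=H_\gamma+\omega-\frac{\omega(\mu+1)(2\mu+1)}{\cosh^2(\mu\sqrt\omega(|x|+y))},\qquad D(L_1)=D(H_\gamma),$$ the real part of the linearization, around the symmetric (odd) stationary state, of the focusing nonlinear Schrödinger equation with power nonlinearity $|\psi|^{2\mu}\psi$ and an attractive $\delta'$ interaction at the origin. Then: a) if $\omega<\omega^*$, then $L_1$ has trivial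 kernel and exactly one negative eigenvalue, which is simple; b) if $\omega=\omega^*$, then $L_1$ has a one-dimensional kernel, spanned by the function $$\xi_{-1}(x)=\frac{\sinh(\mu\sqrt\omega(|x|+y))}{\cosh^{1+\frac1\mu}(\mu\sqrt\omega(|x|+y))},$$ and exactly one negative eigenvalue, which is simple; c) if $\omega>\omega^*$, then $L_1$ has trivial kernel and either exactly two distinct negative eigenvalues, both simple, or exactly one negative eigenvalue, which is double (so exactly two negative eigenvalues, counted with multiplicity). -/

import Mathlib

open MeasureTheory Filter Topology

noncomputable section

namespace DeltaPrime

/-- The complex Hilbert space `L²(ℝ)`. -/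
abbrev L2R : Type := Lp ℂ 2 (volume : Measure ℝ)

/-- `g` is the weak derivative of `f` on `ℝ ∖ {0}`: integration by parts against all smooth
functions with compact support contained in `ℝ ∖ {0}`. -/
def HasWeakDeriv (f g : ℝ → ℂ) : Prop :=
  ∀ φ : ℝ → ℝ, ContDiff ℝ (⊤ : ℕ∞) φ → HasCompactSupport φ → tsupport φ ⊆ {0}ᶜ →
    ∫ x, deriv φ x • f x = -∫ x, φ x • g x

/-- The trace `f(0+) = a`, as an essential one-sided limit, i.e. a limit up to null sets. (For `f`
in the Sobolev space `H¹(0, ∞)` it is the value at `0+` of the continuous representative.) -/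
def TraceRight (f : ℝ → ℂ) (a : ℂ) : Prop :=
  Tendsto f (𝓝[>] 0 ⊓ ae volume) (𝓝 a)

/-- The trace `f(0-) = a`, as an essential one-sided limit. -/
def TraceLeft (f : ℝ → ℂ) (a : ℂ) : Prop :=
  Tendsto f (𝓝[<] 0 ⊓ ae volume) (𝓝 a)

lemma integrable_smul_L2 (u : L2R) {φ : ℝ → ℝ} (hφ : Continuous φ) (hc : HasCompactSupport φ) :
    Integrable (fun x => φ x • u x) := by
  have h : LocallyIntegrable (u : ℝ → ℂ) volume :=
    (Lp.memLp u).locallyIntegrable (by norm_num)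
  exact h.integrable_smul_left_of_hasCompactSupport hφ hc

lemma HasWeakDeriv.congr {f f' g g' : ℝ → ℂ} (h : HasWeakDeriv f g) (hf : f =ᵐ[volume] f')
    (hg : g =ᵐ[volume] g') : HasWeakDeriv f' g' := by
  intro φ h1 h2 h3
  have e1 : ∫ x, deriv φ x • f x = ∫ x, deriv φ x • f' x :=
    integral_congr_ae (hf.mono fun x hx => by simp only [hx])
  have e2 : ∫ x, φ x • g x = ∫ x, φ x • g' x :=
    integral_congr_ae (hg.mono fun x hx => by simp only [hx])
  rw [← e1, ← e2, h φ h1 h2 h3]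

lemma HasWeakDeriv.add_L2 {u u₁ v v₁ : L2R} (hu : HasWeakDeriv u u₁) (hv : HasWeakDeriv v v₁) :
    HasWeakDeriv (u + v : L2R) (u₁ + v₁ : L2R) := by
  refine HasWeakDeriv.congr (f := fun x => u x + v x) (g := fun x => u₁ x + v₁ x) ?_
    (Lp.coeFn_add u v).symm (Lp.coeFn_add u₁ v₁).symm
  intro φ h1 h2 h3
  have hd : Continuous (deriv φ) := h1.continuous_deriv (by simp)
  simp only [smul_add]
  rw [integral_add (integrable_smul_L2 u hd h2.deriv) (integrable_smul_L2 v hd h2.deriv),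
    integral_add (integrable_smul_L2 u₁ h1.continuous h2) (integrable_smul_L2 v₁ h1.continuous h2),
    hu φ h1 h2 h3, hv φ h1 h2 h3, neg_add]

lemma HasWeakDeriv.smul_L2 {u u₁ : L2R} (c : ℂ) (hu : HasWeakDeriv u u₁) :
    HasWeakDeriv (c • u : L2R) (c • u₁ : L2R) := by
  refine HasWeakDeriv.congr (f := fun x => c • u x) (g := fun x => c • u₁ x) ?_
    (Lp.coeFn_smul c u).symm (Lp.coeFn_smul c u₁).symm
  intro φ h1 h2 h3
  simp only [smul_comm _ c]
  rw [integral_smul, integral_smul, hu φ h1 h2 h3, smul_neg]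

lemma HasWeakDeriv.unique_L2 {u u₁ v₁ : L2R} (h : HasWeakDeriv u u₁) (h' : HasWeakDeriv u v₁) :
    u₁ = v₁ := by
  have hl : LocallyIntegrable ((u₁ - v₁ : L2R) : ℝ → ℂ) volume :=
    (Lp.memLp (u₁ - v₁)).locallyIntegrable (by norm_num)
  have key := IsOpen.ae_eq_zero_of_integral_contDiff_smul_eq_zero (μ := (volume : Measure ℝ))
    (U := ({0}ᶜ : Set ℝ)) isOpen_compl_singleton (hl.locallyIntegrableOn _) (by
      intro φ h1 h2 h3
      have e : ∫ x, φ x • (u₁ - v₁ : L2R) x = ∫ x, (φ x • u₁ x - φ x • v₁ x) := by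
        refine integral_congr_ae ?_
        filter_upwards [Lp.coeFn_sub u₁ v₁] with x hx
        rw [hx, Pi.sub_apply, smul_sub]
      rw [e, integral_sub (integrable_smul_L2 u₁ h1.continuous h2)
        (integrable_smul_L2 v₁ h1.continuous h2)]
      have := (h φ h1 h2 h3).symm.trans (h' φ h1 h2 h3)
      rw [neg_inj] at this
      rw [this, sub_self])
  have h0 : ∀ᵐ x : ℝ, x ∈ ({0}ᶜ : Set ℝ) := by
    simp [ae_iff]
  rw [← sub_eq_zero]
  refine Lp.ext ?_
  filter_upwards [key, h0, Lp.coeFn_zero ℂ 2 (volume : Measure ℝ)] with x hx hx0 hz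
  rw [hx hx0, hz]; rfl

/-- `ψ` lies in the domain of the operator `H_γ` of the attractive `δ'` interaction, with first and
second weak derivatives `ψ₁`, `ψ₂`: `ψ ∈ H²(ℝ ∖ {0})`, `ψ'(0+) = ψ'(0-)` and
`ψ(0+) - ψ(0-) = -γ ψ'(0+)`. -/
structure IsDomainElement (γ : ℝ) (ψ ψ₁ ψ₂ : L2R) : Prop where
  weakDeriv_one : HasWeakDeriv ψ ψ₁
  weakDeriv_two : HasWeakDeriv ψ₁ ψ₂
  boundary : ∃ a b d : ℂ, TraceRight ψ a ∧ TraceLeft ψ b ∧ TraceRight ψ₁ d ∧ TraceLeft ψ₁ d ∧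
    a - b = -(γ : ℂ) * d

lemma Trace.congr {l : Filter ℝ} {f g : ℝ → ℂ} {a : ℂ} (h : Tendsto f (l ⊓ ae volume) (𝓝 a))
    (hfg : f =ᵐ[volume] g) : Tendsto g (l ⊓ ae volume) (𝓝 a) :=
  h.congr' (hfg.filter_mono inf_le_right)

lemma Trace.add_L2 {l : Filter ℝ} {u v : L2R} {a b : ℂ} (hu : Tendsto u (l ⊓ ae volume) (𝓝 a))
    (hv : Tendsto v (l ⊓ ae volume) (𝓝 b)) :
    Tendsto (u + v : L2R) (l ⊓ ae volume) (𝓝 (a + b)) :=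
  Trace.congr (hu.add hv) (Lp.coeFn_add u v).symm

lemma Trace.smul_L2 {l : Filter ℝ} {u : L2R} {a : ℂ} (c : ℂ)
    (hu : Tendsto u (l ⊓ ae volume) (𝓝 a)) :
    Tendsto (c • u : L2R) (l ⊓ ae volume) (𝓝 (c * a)) :=
  Trace.congr (hu.const_smul c) (Lp.coeFn_smul c u).symm

lemma IsDomainElement.add {γ : ℝ} {u u₁ u₂ v v₁ v₂ : L2R} (hu : IsDomainElement γ u u₁ u₂)
    (hv : IsDomainElement γ v v₁ v₂) : IsDomainElement γ (u + v) (u₁ + v₁) (u₂ + v₂) := by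
  obtain ⟨a, b, d, h1, h2, h3, h4, h5⟩ := hu.boundary
  obtain ⟨a', b', d', k1, k2, k3, k4, k5⟩ := hv.boundary
  refine ⟨hu.1.add_L2 hv.1, hu.2.add_L2 hv.2, a + a', b + b', d + d', Trace.add_L2 h1 k1,
    Trace.add_L2 h2 k2, Trace.add_L2 h3 k3, Trace.add_L2 h4 k4, ?_⟩
  linear_combination h5 + k5

lemma IsDomainElement.smul {γ : ℝ} {u u₁ u₂ : L2R} (c : ℂ) (hu : IsDomainElement γ u u₁ u₂) :
    IsDomainElement γ (c • u) (c • u₁) (c • u₂) := by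
  obtain ⟨a, b, d, h1, h2, h3, h4, h5⟩ := hu.boundary
  refine ⟨hu.1.smul_L2 c, hu.2.smul_L2 c, c * a, c * b, c * d, Trace.smul_L2 c h1,
    Trace.smul_L2 c h2, Trace.smul_L2 c h3, Trace.smul_L2 c h4, ?_⟩
  linear_combination c * h5

lemma isDomainElement_zero (γ : ℝ) : IsDomainElement γ 0 0 0 := by
  have hw : HasWeakDeriv (0 : L2R) (0 : L2R) := by
    refine HasWeakDeriv.congr (f := fun _ => 0) (g := fun _ => 0) ?_
      (Lp.coeFn_zero ℂ 2 (volume : Measure ℝ)).symm (Lp.coeFn_zero ℂ 2 (volume : Measure ℝ)).symm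
    intro φ _ _ _
    simp
  have ht : ∀ l : Filter ℝ, Tendsto (0 : L2R) (l ⊓ ae volume) (𝓝 0) := fun l =>
    Trace.congr (f := fun _ => 0) tendsto_const_nhds
      (Lp.coeFn_zero ℂ 2 (volume : Measure ℝ)).symm
  exact ⟨hw, hw, 0, 0, 0, ht _, ht _, ht _, ht _, by simp⟩

/-- The graph `{(ψ, -ψ'')}` of `H_γ`. -/
def hamiltonianGraph (γ : ℝ) : Submodule ℂ (L2R × L2R) where
  carrier := {p | ∃ ψ₁ ψ₂ : L2R, IsDomainElement γ p.1 ψ₁ ψ₂ ∧ p.2 = -ψ₂}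
  add_mem' := by
    rintro p q ⟨u₁, u₂, hu, hu'⟩ ⟨v₁, v₂, hv, hv'⟩
    exact ⟨u₁ + v₁, u₂ + v₂, hu.add hv, by rw [Prod.snd_add, hu', hv', neg_add]⟩
  zero_mem' := ⟨0, 0, isDomainElement_zero γ, by simp⟩
  smul_mem' := by
    rintro c p ⟨u₁, u₂, hu, hu'⟩
    exact ⟨c • u₁, c • u₂, hu.smul c, by rw [Prod.smul_snd, hu', smul_neg]⟩

/-- The Hamiltonian `H_γ ψ = -ψ''` (`x ≠ 0`) of the `δ'` interaction, an unbounded operator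
in `L²(ℝ)`. -/
def hamiltonian (γ : ℝ) : L2R →ₗ.[ℂ] L2R :=
  (hamiltonianGraph γ).toLinearPMap

/-- The action of `H_γ` is well defined: its graph is `{(ψ, -ψ'')}`. -/
theorem hamiltonian_graph (γ : ℝ) : (hamiltonian γ).graph = hamiltonianGraph γ := by
  refine Submodule.toLinearPMap_graph_eq _ ?_
  rintro ⟨u, v⟩ ⟨u₁, u₂, hu, hv⟩ h0
  simp only at hu hv h0
  subst h0
  have h1 : u₁ = 0 := hu.1.unique_L2 (isDomainElement_zero γ).1
  subst h1
  have h2 : u₂ = 0 := hu.2.unique_L2 (isDomainElement_zero γ).2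
  rw [hv, h2, neg_zero]

/-- The potential `ω (μ + 1) (2μ + 1) / cosh² (μ √ω (|x| + y))`, which is
`(2μ + 1) λ |ψ|^{2μ}` for the symmetric stationary state `ψ`. -/
def symPotential (μ ω y x : ℝ) : ℝ :=
  ω * (μ + 1) * (2 * μ + 1) / Real.cosh (μ * √ω * (|x| + y)) ^ 2

lemma continuous_symPotential (μ ω y : ℝ) : Continuous (symPotential μ ω y) := by
  unfold symPotential
  refine Continuous.div (by fun_prop) ?_ fun x => ?_
  · exact (Real.continuous_cosh.comp (by fun_prop)).pow 2
  · exact pow_ne_zero _ (Real.cosh_pos _).ne'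

lemma abs_symPotential_le (μ ω y x : ℝ) :
    |symPotential μ ω y x| ≤ |ω * (μ + 1) * (2 * μ + 1)| := by
  unfold symPotential
  rw [abs_div, abs_of_nonneg (sq_nonneg (Real.cosh _))]
  exact div_le_self (abs_nonneg _) (one_le_pow₀ (Real.one_le_cosh _))

lemma memLp_symPotential_mul (μ ω y : ℝ) (u : L2R) :
    MemLp (fun x => (symPotential μ ω y x : ℂ) * u x) 2 volume := by
  refine MemLp.of_le_mul (c := |ω * (μ + 1) * (2 * μ + 1)|) (Lp.memLp u) ?_ ?_
  · exact (Complex.continuous_ofReal.comp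
      (continuous_symPotential μ ω y)).aestronglyMeasurable.mul (Lp.aestronglyMeasurable u)
  · refine Eventually.of_forall fun x => ?_
    rw [norm_mul, Complex.norm_real, Real.norm_eq_abs]
    exact mul_le_mul_of_nonneg_right (abs_symPotential_le μ ω y x) (norm_nonneg _)

/-- Multiplication by the potential, an everywhere defined operator in `L²(ℝ)`. -/
def mulSymPotential (μ ω y : ℝ) : L2R →ₗ[ℂ] L2R where
  toFun u := (memLp_symPotential_mul μ ω y u).toLp _
  map_add' u v := by
    rw [← MemLp.toLp_add]
    refine MemLp.toLp_congr _ _ ?_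
    filter_upwards [Lp.coeFn_add u v] with x hx
    simp only [hx, Pi.add_apply, mul_add]
  map_smul' c u := by
    rw [RingHom.id_apply, ← MemLp.toLp_const_smul]
    refine MemLp.toLp_congr _ _ ?_
    filter_upwards [Lp.coeFn_smul c u] with x hx
    simp only [hx, Pi.smul_apply, smul_eq_mul]
    ring

/-- The operator `L₁ = H_γ + ω - ω (μ + 1) (2μ + 1) / cosh² (μ √ω (|x| + y))` with domain
`D(L₁) = D(H_γ)`, an unbounded operator in `L²(ℝ)`. -/
def L1sym (γ μ ω y : ℝ) : L2R →ₗ.[ℂ] L2R :=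
  ((ω : ℂ) • LinearMap.id - mulSymPotential μ ω y) +ᵥ hamiltonian γ

/-- The eigenspace `{u ∈ D(T) | T u = z u}` of an unbounded operator. -/
def eigenspace {E : Type*} [AddCommGroup E] [Module ℂ E] (T : E →ₗ.[ℂ] E) (z : ℂ) :
    Submodule ℂ E :=
  (LinearMap.ker (T.toFun - z • T.domain.subtype)).map T.domain.subtype

/-- The kernel `{u ∈ D(T) | T u = 0}` of an unbounded operator. -/
def kernel {E : Type*} [AddCommGroup E] [Module ℂ E] (T : E →ₗ.[ℂ] E) : Submodule ℂ E :=
  (LinearMap.ker T.toFun).map T.domain.subtype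

/-- The set of the negative eigenvalues. -/
def negEigenvalues {E : Type*} [AddCommGroup E] [Module ℂ E] (T : E →ₗ.[ℂ] E) : Set ℝ :=
  {ν | ν < 0 ∧ eigenspace T ν ≠ ⊥}

/-- The function `ξ₋₁`. -/
def xiMinusOne (μ ω y x : ℝ) : ℝ :=
  Real.sinh (μ * √ω * (|x| + y)) / Real.cosh (μ * √ω * (|x| + y)) ^ (1 + 1 / μ)

/-- The frequency `ω₀ = 4 / γ²` of the linear ground state. -/
def omegaZero (γ : ℝ) : ℝ :=
  4 / γ ^ 2

/-- The bifurcation frequency `ω* = (4 / γ²) (μ + 1) / μ`. -/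
def omegaStar (γ μ : ℝ) : ℝ :=
  4 / γ ^ 2 * ((μ + 1) / μ)

/-- The parameter `y = (2μ√ω)⁻¹ log ((γ√ω + 2) / (γ√ω - 2))` of the symmetric stationary state.
For `ω > ω₀` it is the solution of `tanh (μ √ω y) = 2 / (γ √ω)`. -/
def symShift (γ μ ω : ℝ) : ℝ :=
  1 / (2 * μ * √ω) * Real.log ((γ * √ω + 2) / (γ * √ω - 2))

end DeltaPrime

end

/-!
On each half-line the equation `L₁ ψ = (ω - κ²) ψ` is a Pöschl–Teller equation, and its square
integrable solutions are the multiples of a single positive function of `|x|`, which is explicit in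
terms of the hypergeometric function. With coefficients `c` on the right and `d` on the left, the
`δ'` boundary conditions decouple: there is an even solution if the logarithmic derivative of this
function at `0+` vanishes, an odd one if it equals `-2 / γ`, and otherwise none.

By Sturm comparison this logarithmic derivative decreases strictly in `κ`, so that it maps
`(√ω, ∞)` bijectively onto `(-∞, m)`. Here `m` is the logarithmic derivative at `κ = √ω`, where the
solution is `ξ₋₁`, and `m = μ γ (ω - ω*) / 2 > -2 / γ`. Hence there is always exactly one odd
negative eigenstate, and an even one if and only if `ω > ω*`; for `ω = ω*` it has become the
element `ξ₋₁` of the kernel.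
-/

noncomputable section

namespace DeltaPrime

/-! ### The hypergeometric function on the unit disc -/

lemma summable_add_one_pow_mul_geometric (p : ℕ) {r : ℝ} (h0 : 0 < r) (h1 : r < 1) :
    Summable fun n : ℕ => ((n : ℝ) + 1) ^ p * r ^ n := by
  have h := summable_pow_mul_geometric_of_norm_lt_one (R := ℝ) p (r := r)
    (by rwa [Real.norm_of_nonneg h0.le])
  refine (((summable_nat_add_iff 1).2 h).mul_right r⁻¹).congr fun n => ?_
  push_cast
  rw [pow_succ]
  field_simp

lemma norm_mul_pow_le {c M z r : ℝ} {n p : ℕ} (hc : |c| ≤ M * ((n : ℝ) + 1) ^ p) (hz : |z| ≤ r) :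
    ‖c * z ^ n‖ ≤ M * (((n : ℝ) + 1) ^ p * r ^ n) := by
  rw [norm_mul, norm_pow, Real.norm_eq_abs, Real.norm_eq_abs, ← mul_assoc]
  exact mul_le_mul hc (pow_le_pow_left₀ (abs_nonneg _) hz _) (by positivity)
    ((abs_nonneg _).trans hc)

lemma summable_powerSeries {c : ℕ → ℝ} {M : ℝ} {p : ℕ} (hc : ∀ n, |c n| ≤ M * ((n : ℝ) + 1) ^ p)
    {z : ℝ} (hz : |z| < 1) : Summable fun n => c n * z ^ n := by
  obtain ⟨r, h1, h2⟩ := exists_between hz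
  exact Summable.of_norm_bounded ((summable_add_one_pow_mul_geometric p
    ((abs_nonneg z).trans_lt h1) h2).mul_left M) fun n => norm_mul_pow_le (hc n) h1.le

lemma continuousOn_powerSeries_param {X : Type*} [TopologicalSpace X] {c : X → ℕ → ℝ} {S : Set X}
    {M : ℝ} {p : ℕ} (hcont : ∀ n, ContinuousOn (fun k => c k n) S)
    (hc : ∀ k ∈ S, ∀ n, |c k n| ≤ M * ((n : ℝ) + 1) ^ p) {z : ℝ} (hz : |z| < 1) :
    ContinuousOn (fun k => ∑' n, c k n * z ^ n) S := by
  obtain ⟨r, h1, h2⟩ := exists_between hz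
  exact continuousOn_tsum (fun n => (hcont n).mul continuousOn_const)
    ((summable_add_one_pow_mul_geometric p ((abs_nonneg z).trans_lt h1) h2).mul_left M)
    fun n k hk => norm_mul_pow_le (hc k hk n) h1.le

lemma norm_mul_natCast_mul_pow_le {c : ℕ → ℝ} {M r x : ℝ} {p : ℕ}
    (hc : ∀ n, |c n| ≤ M * ((n : ℝ) + 1) ^ p) (hr : 0 < r) (hx : |x| ≤ r) (n : ℕ) :
    ‖c n * ((n : ℝ) * x ^ (n - 1))‖ ≤ M * r⁻¹ * (((n : ℝ) + 1) ^ (p + 1) * r ^ n) := by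
  have hM : 0 ≤ M := by simpa using (abs_nonneg _).trans (hc 0)
  rcases n with _ | n
  · rw [Nat.cast_zero, zero_mul, mul_zero, norm_zero]
    positivity
  · rw [norm_mul, norm_mul, norm_pow]
    simp only [Real.norm_eq_abs, Nat.abs_cast, Nat.add_sub_cancel]
    calc |c (n + 1)| * (((n + 1 : ℕ) : ℝ) * |x| ^ n)
        ≤ (M * (((n + 1 : ℕ) : ℝ) + 1) ^ p) * ((((n + 1 : ℕ) : ℝ) + 1) * r ^ n) := by
          gcongr
          · exact hc _
          · linarith
      _ = M * r⁻¹ * ((((n + 1 : ℕ) : ℝ) + 1) ^ (p + 1) * r ^ (n + 1)) := by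
          rw [pow_succ r n, pow_succ _ p]
          field_simp

lemma hasDerivAt_powerSeries {c : ℕ → ℝ} {M : ℝ} {p : ℕ}
    (hc : ∀ n, |c n| ≤ M * ((n : ℝ) + 1) ^ p) {z : ℝ} (hz : |z| < 1) :
    HasDerivAt (fun z => ∑' n, c n * z ^ n) (∑' n : ℕ, (((n : ℝ) + 1) * c (n + 1)) * z ^ n) z := by
  obtain ⟨r, hzr, hr1⟩ := exists_between hz
  have hr0 : 0 < r := (abs_nonneg z).trans_lt hzr
  have hs : Summable fun n : ℕ => M * r⁻¹ * (((n : ℝ) + 1) ^ (p + 1) * r ^ n) :=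
    (summable_add_one_pow_mul_geometric (p + 1) hr0 hr1).mul_left _
  have hb (n : ℕ) (x : ℝ) (hx : x ∈ Metric.ball (0 : ℝ) r) :=
    norm_mul_natCast_mul_pow_le hc hr0 (mem_ball_zero_iff.1 hx).le n
  have hz' : z ∈ Metric.ball (0 : ℝ) r := mem_ball_zero_iff.2 hzr
  have key := hasDerivAt_tsum_of_isPreconnected (g := fun n z => c n * z ^ n)
    (g' := fun n z => c n * ((n : ℝ) * z ^ (n - 1))) hs Metric.isOpen_ball
    (convex_ball (0 : ℝ) r).isPreconnected (fun n x _ => (hasDerivAt_pow n x).const_mul (c n)) hb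
    (Metric.mem_ball_self hr0) (summable_powerSeries hc (by simp)) hz'
  rw [(Summable.of_norm_bounded hs fun n => hb n z hz').tsum_eq_zero_add] at key
  simp only [Nat.cast_zero, zero_mul, mul_zero, zero_add, Nat.add_sub_cancel] at key
  convert! key using 3
  push_cast
  ring

lemma hasSum_natCast_mul_powerSeries {c : ℕ → ℝ} {z S : ℝ}
    (h : HasSum (fun n : ℕ => (((n : ℝ) + 1) * c (n + 1)) * z ^ n) S) :
    HasSum (fun n : ℕ => ((n : ℝ) * c n) * z ^ n) (z * S) := by
  have := HasSum.zero_add (f := fun n : ℕ => ((n : ℝ) * c n) * z ^ n) (m := z * S) (by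
    refine (h.mul_left z).congr_fun fun n => ?_
    push_cast
    ring)
  simpa only [Nat.cast_zero, zero_mul, zero_add] using this

lemma ordinaryHypergeometricCoefficient_succ (a b : ℝ) {c : ℝ} (hc : 0 < c) (n : ℕ) :
    ((n : ℝ) + 1) * (n + c) * ordinaryHypergeometricCoefficient a b c (n + 1) =
      (n + a) * (n + b) * ordinaryHypergeometricCoefficient a b c n := by
  have : (0 : ℝ) < n + c := by positivity
  have h2 := ascPochhammer_pos n c hc
  simp only [ordinaryHypergeometricCoefficient, ascPochhammer_succ_eval, Nat.factorial_succ]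
  push_cast
  field_simp
  ring

lemma succ_mul_ordinaryHypergeometricCoefficient_succ (a b c : ℝ) (n : ℕ) :
    ((n : ℝ) + 1) * ordinaryHypergeometricCoefficient a b c (n + 1) =
      a * b / c * ordinaryHypergeometricCoefficient (a + 1) (b + 1) (c + 1) n := by
  simp only [ordinaryHypergeometricCoefficient, ascPochhammer_succ_left, Nat.factorial_succ,
    Polynomial.eval_mul, Polynomial.eval_comp, Polynomial.eval_add, Polynomial.eval_X,
    Polynomial.eval_one]
  push_cast
  field_simp

lemma abs_add_mul_add_le {x : ℝ} (hx : 0 ≤ x) (a b : ℝ) :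
    |(x + a) * (x + b)| ≤ (x + 1) ^ 2 * (1 + (|a| + |b| + |a| * |b|) / (x + 1)) := by
  have ha : |x + a| ≤ x + |a| := (abs_add_le _ _).trans_eq (by rw [abs_of_nonneg hx])
  have hb : |x + b| ≤ x + |b| := (abs_add_le _ _).trans_eq (by rw [abs_of_nonneg hx])
  rw [abs_mul]
  calc |x + a| * |x + b| ≤ (x + |a|) * (x + |b|) := by gcongr
    _ ≤ (x + 1) ^ 2 + (|a| + |b| + |a| * |b|) * (x + 1) := by
      nlinarith [abs_nonneg a, abs_nonneg b,
        mul_nonneg hx (mul_nonneg (abs_nonneg a) (abs_nonneg b))]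
    _ = _ := by field_simp

lemma pow_mul_one_add_div_le {x : ℝ} (hx : 0 < x) (p : ℕ) :
    x ^ p * (1 + p / x) ≤ (x + 1) ^ p := by
  have bernoulli := one_add_mul_le_pow (a := 1 / x) (by linarith [one_div_pos.2 hx]) p
  calc x ^ p * (1 + p / x) ≤ x ^ p * (1 + 1 / x) ^ p := by
        gcongr
        rwa [mul_one_div] at bernoulli
    _ = (x + 1) ^ p := by
        rw [← mul_pow, mul_one_add, mul_one_div_cancel hx.ne']

lemma abs_ordinaryHypergeometricCoefficient_le {a b c : ℝ} {p : ℕ} (hc : 1 ≤ c)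
    (hp : |a| + |b| + |a| * |b| ≤ p) (n : ℕ) :
    |ordinaryHypergeometricCoefficient a b c n| ≤ ((n : ℝ) + 1) ^ p := by
  induction n with
  | zero => simp [ordinaryHypergeometricCoefficient]
  | succ n ih =>
    have hc0 : 0 < c := by linarith
    have hn : (0 : ℝ) < (n : ℝ) + 1 := by positivity
    have hrec : ((n : ℝ) + 1) * (n + c) * |ordinaryHypergeometricCoefficient a b c (n + 1)| =
        |((n : ℝ) + a) * (n + b)| * |ordinaryHypergeometricCoefficient a b c n| := by
      rw [← abs_mul, ← ordinaryHypergeometricCoefficient_succ a b hc0 n,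
        abs_mul (((n : ℝ) + 1) * (n + c)),
        abs_of_pos (by positivity : 0 < ((n : ℝ) + 1) * (n + c))]
    push_cast
    refine le_of_mul_le_mul_left ?_ (pow_pos hn 2)
    calc ((n : ℝ) + 1) ^ 2 * |ordinaryHypergeometricCoefficient a b c (n + 1)|
        ≤ ((n : ℝ) + 1) * (n + c) * |ordinaryHypergeometricCoefficient a b c (n + 1)| := by
          rw [sq]
          gcongr
      _ ≤ ((n : ℝ) + 1) ^ 2 * (1 + p / (n + 1)) * ((n : ℝ) + 1) ^ p := by
          rw [hrec]
          gcongr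
          exact (abs_add_mul_add_le n.cast_nonneg a b).trans (by gcongr)
      _ ≤ ((n : ℝ) + 1) ^ 2 * ((n : ℝ) + 1 + 1) ^ p := by
          rw [mul_assoc, mul_comm (1 + _)]
          gcongr
          exact pow_mul_one_add_div_le hn p

lemma exists_ordinaryHypergeometricCoefficient_bound (a b : ℝ) :
    ∃ p : ℕ, ∀ c, 1 ≤ c → ∀ n,
      |ordinaryHypergeometricCoefficient a b c n| ≤ 1 * ((n : ℝ) + 1) ^ p := by
  obtain ⟨p, hp⟩ := exists_nat_ge (|a| + |b| + |a| * |b|)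
  exact ⟨p, fun c hc n => by
    simpa only [one_mul] using abs_ordinaryHypergeometricCoefficient_le hc hp n⟩

lemma hasSum_ordinaryHypergeometric (a b : ℝ) {c z : ℝ} (hc : 1 ≤ c) (hz : |z| < 1) :
    HasSum (fun n => ordinaryHypergeometricCoefficient a b c n * z ^ n) (₂F₁ a b c z) := by
  obtain ⟨p, hp⟩ := exists_ordinaryHypergeometricCoefficient_bound a b
  rw [ordinaryHypergeometric_eq_tsum]
  exact (summable_powerSeries (hp c hc) hz).hasSum

/-- The derivative of `₂F₁ a b c`. -/
def ordinaryHypergeometricDeriv (a b c z : ℝ) : ℝ := a * b / c * ₂F₁ (a + 1) (b + 1) (c + 1) z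

lemma hasDerivAt_ordinaryHypergeometric (a b : ℝ) {c z : ℝ} (hc : 1 ≤ c) (hz : |z| < 1) :
    HasDerivAt (₂F₁ a b c : ℝ → ℝ) (ordinaryHypergeometricDeriv a b c z) z := by
  obtain ⟨p, hp⟩ := exists_ordinaryHypergeometricCoefficient_bound a b
  convert! hasDerivAt_powerSeries (hp c hc) hz using 1
  · exact ordinaryHypergeometric_eq_tsum a b c
  · rw [ordinaryHypergeometricDeriv, ordinaryHypergeometric_eq_tsum, ← tsum_mul_left]
    refine tsum_congr fun n => ?_
    rw [succ_mul_ordinaryHypergeometricCoefficient_succ, smul_eq_mul]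
    ring

lemma continuousOn_ordinaryHypergeometric_param (a b : ℝ) {z : ℝ} (hz : |z| < 1) :
    ContinuousOn (fun c : ℝ => ₂F₁ a b c z) (Set.Ici 1) := by
  obtain ⟨p, hp⟩ := exists_ordinaryHypergeometricCoefficient_bound a b
  simp only [ordinaryHypergeometric_eq_tsum]
  refine continuousOn_powerSeries_param (fun n => ?_) hp hz
  refine continuousOn_const.mul ((Polynomial.continuous _).continuousOn.inv₀ fun c hc => ?_)
  exact (ascPochhammer_pos n c (zero_lt_one.trans_le hc)).ne'

lemma hasDerivAt_ordinaryHypergeometricDeriv (a b : ℝ) {c z : ℝ} (hc : 1 ≤ c) (hz : |z| < 1) :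
    HasDerivAt (ordinaryHypergeometricDeriv a b c)
      (a * b / c * ordinaryHypergeometricDeriv (a + 1) (b + 1) (c + 1) z) z :=
  (hasDerivAt_ordinaryHypergeometric (a + 1) (b + 1) (by linarith) hz).const_mul _

lemma ordinaryHypergeometric_ode (a b : ℝ) {c z : ℝ} (hc : 1 ≤ c) (hz : |z| < 1) :
    z * (1 - z) * (a * b / c * ordinaryHypergeometricDeriv (a + 1) (b + 1) (c + 1) z)
      + (c - (a + b + 1) * z) * ordinaryHypergeometricDeriv a b c z = a * b * ₂F₁ a b c z := by
  have hc1 : 1 ≤ c + 1 := by linarith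
  set d := ordinaryHypergeometricCoefficient a b c
  set F'' := a * b / c * ordinaryHypergeometricDeriv (a + 1) (b + 1) (c + 1) z
  have s0 : HasSum (fun n => d n * z ^ n) (₂F₁ a b c z) := hasSum_ordinaryHypergeometric a b hc hz
  have s1 : HasSum (fun n : ℕ => (((n : ℝ) + 1) * d (n + 1)) * z ^ n)
      (ordinaryHypergeometricDeriv a b c z) := by
    refine ((hasSum_ordinaryHypergeometric _ _ hc1 hz).mul_left _).congr_fun fun n => ?_
    rw [succ_mul_ordinaryHypergeometricCoefficient_succ, mul_assoc]
  have s2 : HasSum (fun n : ℕ =>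
      (((n : ℝ) + 1) * ((((n + 1 : ℕ) : ℝ) + 1) * d (n + 1 + 1))) * z ^ n) F'' := by
    refine (((hasSum_ordinaryHypergeometric _ _ (by linarith : 1 ≤ c + 1 + 1) hz).mul_left
      _).mul_left _).congr_fun fun n => ?_
    rw [succ_mul_ordinaryHypergeometricCoefficient_succ, mul_left_comm,
      succ_mul_ordinaryHypergeometricCoefficient_succ]
    ring
  have t1 := hasSum_natCast_mul_powerSeries s1
  have t2 := hasSum_natCast_mul_powerSeries (c := fun n => ((n : ℝ) + 1) * d (n + 1)) s2
  have t3 := hasSum_natCast_mul_powerSeries (c := fun n => ((n : ℝ) - 1) * d n)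
    (t2.congr_fun fun n => by push_cast; ring)
  have total := ((t2.sub t3).add (s1.mul_left c)).sub ((t1.mul_left (a + b + 1)).add
    (s0.mul_left (a * b)))
  have e := total.unique (hasSum_zero.congr_fun fun n => by
    linear_combination z ^ n * ordinaryHypergeometricCoefficient_succ a b (by linarith : 0 < c) n)
  linear_combination e

/-! ### Sturm comparison for exponentially decaying solutions -/

/-- `u` with derivative `v` solves `u'' = Q u` and both decay exponentially at `+∞`: these are the
solutions on the line that can be square integrable near `+∞`. -/
structure IsDecayingSolution (Q u v : ℝ → ℝ) : Prop where
  hasDerivAt : ∀ x, HasDerivAt u (v x) x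
  hasDerivAt_deriv : ∀ x, HasDerivAt v (Q x * u x) x
  isBigO_exp : ∃ κ > 0, u =O[atTop] (fun x => Real.exp (-κ * x)) ∧
    v =O[atTop] (fun x => Real.exp (-κ * x))

lemma hasDerivAt_exp_const_mul (c x : ℝ) :
    HasDerivAt (fun x => Real.exp (c * x)) (c * Real.exp (c * x)) x := by
  simpa [mul_comm] using ((hasDerivAt_id x).const_mul c).exp

lemma isDecayingSolution_exp {M : ℝ} (hM : 0 < M) :
    IsDecayingSolution (fun _ => M ^ 2) (fun x => Real.exp (-M * x))
      (fun x => -M * Real.exp (-M * x)) where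
  hasDerivAt := hasDerivAt_exp_const_mul (-M)
  hasDerivAt_deriv x := by
    convert! (hasDerivAt_exp_const_mul (-M) x).const_mul (-M) using 1
    ring
  isBigO_exp := ⟨M, hM, Asymptotics.isBigO_refl _ _, Asymptotics.isBigO_const_mul_self _ _ _⟩

lemma tendsto_exp_neg_const_mul {κ : ℝ} (hκ : 0 < κ) :
    Tendsto (fun x : ℝ => Real.exp (-κ * x)) atTop (𝓝 0) :=
  Real.tendsto_exp_atBot.comp (tendsto_id.const_mul_atTop_of_neg (neg_lt_zero.2 hκ))

lemma exists_zero_of_eventually_pos {u : ℝ → ℝ} (hu : Continuous u)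
    (h : ∀ᶠ x in atTop, 0 < u x) {x₁ : ℝ} (hx₁ : u x₁ ≤ 0) :
    ∃ x₀, x₁ ≤ x₀ ∧ u x₀ = 0 ∧ ∀ x, x₀ < x → 0 < u x := by
  obtain ⟨X, hX⟩ := eventually_atTop.1 h
  have lt_X : ∀ x, u x ≤ 0 → x ≤ X := fun x hx => le_of_not_ge fun hxX => (hX x hxX).not_ge hx
  have hcomp : IsCompact (Set.Icc x₁ X ∩ {x | u x ≤ 0}) :=
    isCompact_Icc.inter_right (isClosed_le hu continuous_const)
  obtain ⟨x₀, ⟨⟨hx₀, -⟩, hx₀n⟩, hmax⟩ :=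
    hcomp.exists_isGreatest ⟨x₁, ⟨le_rfl, lt_X x₁ hx₁⟩, hx₁⟩
  have hpos : ∀ x, x₀ < x → 0 < u x := fun x hx =>
    lt_of_not_ge fun hn => (hmax ⟨⟨hx₀.trans hx.le, lt_X x hn⟩, hn⟩).not_gt hx
  have hnonneg : 0 ≤ u x₀ := by
    refine ge_of_tendsto (hu.continuousAt.mono_left nhdsWithin_le_nhds :
      Tendsto u (𝓝[>] x₀) (𝓝 (u x₀))) ?_
    filter_upwards [self_mem_nhdsWithin] with x hx using (hpos x hx).le
  exact ⟨x₀, hx₀, le_antisymm hx₀n hnonneg, hpos⟩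

lemma deriv_nonneg_of_zero_of_pos_right {u : ℝ → ℝ} {v x₀ : ℝ} (hu : HasDerivAt u v x₀)
    (h0 : u x₀ = 0) (hpos : ∀ x, x₀ < x → 0 < u x) : 0 ≤ v := by
  have hd := hu.hasDerivWithinAt (s := Set.Ioi x₀)
  rw [hasDerivWithinAt_iff_tendsto_slope' Set.self_notMem_Ioi] at hd
  refine ge_of_tendsto hd ?_
  filter_upwards [self_mem_nhdsWithin] with x hx
  rw [slope_def_field, h0, sub_zero]
  exact div_nonneg (hpos x hx).le (sub_nonneg.2 (le_of_lt hx))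

namespace IsDecayingSolution

variable {Q Q₁ Q₂ u u₁ u₂ v v₁ v₂ : ℝ → ℝ} {b : ℝ}

lemma continuous (h : IsDecayingSolution Q u v) : Continuous u :=
  continuous_iff_continuousAt.2 fun x => (h.hasDerivAt x).continuousAt

lemma continuous_deriv (h : IsDecayingSolution Q u v) : Continuous v :=
  continuous_iff_continuousAt.2 fun x => (h.hasDerivAt_deriv x).continuousAt

lemma contDiff (h : IsDecayingSolution Q u v) (hQ : ContDiff ℝ (⊤ : ℕ∞) Q) :
    ContDiff ℝ (⊤ : ℕ∞) u ∧ ContDiff ℝ (⊤ : ℕ∞) v := by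
  have hu : deriv u = v := funext fun x => (h.hasDerivAt x).deriv
  have hv : deriv v = fun x => Q x * u x := funext fun x => (h.hasDerivAt_deriv x).deriv
  have bootstrap : ∀ n : ℕ, ContDiff ℝ n u ∧ ContDiff ℝ n v := by
    intro n
    induction n with
    | zero => exact ⟨contDiff_zero.2 h.continuous, contDiff_zero.2 h.continuous_deriv⟩
    | succ n ih =>
      have hQn : ContDiff ℝ n Q := hQ.of_le (by exact_mod_cast le_top)
      rw [Nat.cast_add, Nat.cast_one, contDiff_succ_iff_deriv, contDiff_succ_iff_deriv]
      exact ⟨⟨fun x => (h.hasDerivAt x).differentiableAt, by simp, hu ▸ ih.2⟩,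
        fun x => (h.hasDerivAt_deriv x).differentiableAt, by simp, hv ▸ hQn.mul ih.1⟩
  exact ⟨contDiff_infty.2 fun n => (bootstrap n).1, contDiff_infty.2 fun n => (bootstrap n).2⟩

lemma tendsto_zero (h : IsDecayingSolution Q u v) :
    Tendsto u atTop (𝓝 0) ∧ Tendsto v atTop (𝓝 0) := by
  obtain ⟨κ, hκ, hu, hv⟩ := h.isBigO_exp
  exact ⟨hu.trans_tendsto (tendsto_exp_neg_const_mul hκ),
    hv.trans_tendsto (tendsto_exp_neg_const_mul hκ)⟩

lemma hasDerivAt_wronskian (h₁ : IsDecayingSolution Q₁ u₁ v₁) (h₂ : IsDecayingSolution Q₂ u₂ v₂)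
    (x : ℝ) : HasDerivAt (fun x => u₁ x * v₂ x - v₁ x * u₂ x)
      ((Q₂ x - Q₁ x) * (u₁ x * u₂ x)) x := by
  convert! ((h₁.hasDerivAt x).mul (h₂.hasDerivAt_deriv x)).sub
    ((h₁.hasDerivAt_deriv x).mul (h₂.hasDerivAt x)) using 1
  ring

lemma tendsto_wronskian (h₁ : IsDecayingSolution Q₁ u₁ v₁) (h₂ : IsDecayingSolution Q₂ u₂ v₂) :
    Tendsto (fun x => u₁ x * v₂ x - v₁ x * u₂ x) atTop (𝓝 0) := by
  simpa using (h₁.tendsto_zero.1.mul h₂.tendsto_zero.2).sub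
    (h₁.tendsto_zero.2.mul h₂.tendsto_zero.1)

lemma slope_lt (h₁ : IsDecayingSolution Q₁ u₁ v₁) (h₂ : IsDecayingSolution Q₂ u₂ v₂)
    (hQ : ∀ x, b < x → Q₂ x < Q₁ x) (p₁ : ∀ x, b < x → 0 < u₁ x) (p₂ : ∀ x, b < x → 0 < u₂ x) :
    v₁ b * u₂ b < u₁ b * v₂ b := by
  have hW := hasDerivAt_wronskian h₁ h₂
  have anti : StrictAntiOn (fun x => u₁ x * v₂ x - v₁ x * u₂ x) (Set.Ici b) := by
    refine strictAntiOn_of_deriv_neg (convex_Ici b)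
      (fun x _ => (hW x).continuousAt.continuousWithinAt) fun x hx => ?_
    rw [interior_Ici, Set.mem_Ioi] at hx
    rw [(hW x).deriv]
    exact mul_neg_of_neg_of_pos (sub_neg.2 (hQ x hx)) (mul_pos (p₁ x hx) (p₂ x hx))
  have hb : b ∈ Set.Ici b := Set.self_mem_Ici
  have hb1 : b + 1 ∈ Set.Ici b := (lt_add_one b).le
  have nonneg : 0 ≤ u₁ (b + 1) * v₂ (b + 1) - v₁ (b + 1) * u₂ (b + 1) := by
    refine le_of_tendsto (tendsto_wronskian h₁ h₂) ?_
    filter_upwards [eventually_ge_atTop (b + 1)] with x hx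
    exact anti.antitoneOn hb1 (hb1.trans hx) hx
  exact sub_pos.1 (nonneg.trans_lt (anti hb hb1 (lt_add_one b)))

lemma wronskian_eq_zero (h₁ : IsDecayingSolution Q u₁ v₁) (h₂ : IsDecayingSolution Q u₂ v₂)
    (x : ℝ) : u₁ x * v₂ x - v₁ x * u₂ x = 0 := by
  have hW : ∀ x, HasDerivAt (fun x => u₁ x * v₂ x - v₁ x * u₂ x) 0 x := fun x => by
    simpa using hasDerivAt_wronskian h₁ h₂ x
  refine tendsto_nhds_unique (tendsto_const_nhds.congr fun z => ?_) (tendsto_wronskian h₁ h₂)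
  exact is_const_of_deriv_eq_zero (fun x => (hW x).differentiableAt) (fun x => (hW x).deriv) x z

lemma pos_of_eventually_pos (h₁ : IsDecayingSolution Q₁ u₁ v₁) (h₂ : IsDecayingSolution Q₂ u₂ v₂)
    (hQ : ∀ x, b ≤ x → Q₂ x < Q₁ x) (p₁ : ∀ᶠ x in atTop, 0 < u₁ x) (p₂ : ∀ x, b ≤ x → 0 < u₂ x)
    {x : ℝ} (hx : b ≤ x) : 0 < u₁ x := by
  by_contra! hneg
  obtain ⟨x₀, hx₀, hzero, hpos⟩ := exists_zero_of_eventually_pos h₁.continuous p₁ hneg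
  have hv : 0 ≤ v₁ x₀ := deriv_nonneg_of_zero_of_pos_right (h₁.hasDerivAt x₀) hzero hpos
  have hb : ∀ x, x₀ < x → b ≤ x := fun x hx' => (hx.trans hx₀).trans hx'.le
  have hlt := slope_lt h₁ h₂ (fun x hx => hQ x (hb x hx)) hpos fun x hx => p₂ x (hb x hx)
  rw [hzero, zero_mul] at hlt
  exact hlt.not_ge (mul_nonneg hv (p₂ x₀ (hx.trans hx₀)).le)

lemma pos_of_eventually_pos_of_pos (h₁ : IsDecayingSolution Q u₁ v₁)
    (h₂ : IsDecayingSolution Q u₂ v₂) (p₁ : ∀ᶠ x in atTop, 0 < u₁ x)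
    (p₂ : ∀ x, b ≤ x → 0 < u₂ x) {x : ℝ} (hx : b ≤ x) : 0 < u₁ x := by
  have hd : ∀ t, b ≤ t → HasDerivAt (fun x => u₁ x / u₂ x) 0 t := fun t ht => by
    have := (h₁.hasDerivAt t).div (h₂.hasDerivAt t) (p₂ t ht).ne'
    rwa [show v₁ t * u₂ t - u₁ t * v₂ t = 0 by linarith [wronskian_eq_zero h₁ h₂ t],
      zero_div] at this
  obtain ⟨X, hX, hxX⟩ := (p₁.and (eventually_ge_atTop x)).exists
  have hconst : u₁ X / u₂ X = u₁ x / u₂ x :=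
    constant_of_has_deriv_right_zero (a := x) (b := X)
      (fun t ht => (hd t (hx.trans ht.1)).continuousAt.continuousWithinAt)
      (fun t ht => (hd t (hx.trans ht.1)).hasDerivWithinAt) X ⟨hxX, le_rfl⟩
  have hquot : 0 < u₁ x / u₂ x := hconst ▸ div_pos hX (p₂ X (hx.trans hxX))
  exact (div_pos_iff_of_pos_right (p₂ x hx)).1 hquot

end IsDecayingSolution

/-! ### The Pöschl–Teller equation on the half-line -/

lemma one_sub_tanh_sq (θ : ℝ) : 1 - Real.tanh θ ^ 2 = 1 / Real.cosh θ ^ 2 := by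
  have := Real.cosh_pos θ
  rw [Real.tanh_eq_sinh_div_cosh]
  field_simp
  linarith [Real.cosh_sq θ]

lemma tanh_pos {θ : ℝ} (hθ : 0 < θ) : 0 < Real.tanh θ := by
  rw [Real.tanh_eq_sinh_div_cosh]
  exact div_pos (Real.sinh_pos_iff.2 hθ) (Real.cosh_pos θ)

lemma tendsto_tanh_atTop : Tendsto Real.tanh atTop (𝓝 1) := by
  have key : ∀ θ, 1 - Real.tanh θ ≤ Real.exp (-θ) := fun θ => by
    rw [Real.tanh_eq_sinh_div_cosh, one_sub_div (Real.cosh_pos θ).ne', Real.cosh_sub_sinh]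
    exact div_le_self (Real.exp_pos _).le (Real.one_le_cosh θ)
  have h := squeeze_zero (fun θ => (sub_pos.2 (Real.tanh_lt_one θ)).le) key
    (Real.tendsto_exp_atBot.comp tendsto_neg_atTop_atBot)
  simpa using h.const_sub 1

lemma hasDerivAt_tanh_affine (a y x : ℝ) :
    HasDerivAt (fun x => Real.tanh (a * (x + y))) (a * (1 - Real.tanh (a * (x + y)) ^ 2)) x := by
  have hθ : HasDerivAt (fun x => a * (x + y)) a x := by
    simpa using ((hasDerivAt_id x).add_const y).const_mul a
  simp only [Real.tanh_eq_sinh_div_cosh]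
  convert! hθ.sinh.div hθ.cosh (Real.cosh_pos _).ne' using 1
  have := Real.cosh_pos (a * (x + y))
  field_simp

lemma tendsto_affine_atTop {a : ℝ} (ha : 0 < a) (y : ℝ) :
    Tendsto (fun x => a * (x + y)) atTop atTop :=
  (tendsto_atTop_add_const_right _ y tendsto_id).const_mul_atTop ha

/-- The coefficient `κ² - a² s (s + 1) / cosh² (a (x + y))` of the Pöschl–Teller equation at the
energy `-κ²`. -/
def ptCoeff (a y s κ x : ℝ) : ℝ := κ ^ 2 - a ^ 2 * (s * (s + 1)) / Real.cosh (a * (x + y)) ^ 2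

lemma ptCoeff_eq (a y s κ x : ℝ) : ptCoeff a y s κ x =
    κ ^ 2 - a ^ 2 * (s * (s + 1)) * (1 - Real.tanh (a * (x + y)) ^ 2) := by
  rw [ptCoeff, one_sub_tanh_sq, mul_one_div]

lemma ptCoeff_lt_ptCoeff {κ κ' : ℝ} (hκ : 0 ≤ κ) (h : κ < κ') (a y s x : ℝ) :
    ptCoeff a y s κ x < ptCoeff a y s κ' x :=
  sub_lt_sub_right (pow_lt_pow_left₀ h hκ two_ne_zero) _

lemma contDiff_ptCoeff (a y s κ : ℝ) : ContDiff ℝ (⊤ : ℕ∞) (ptCoeff a y s κ) := by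
  unfold ptCoeff
  refine contDiff_const.sub (contDiff_const.div ?_ fun x => pow_ne_zero _ (Real.cosh_pos _).ne')
  exact (Real.contDiff_cosh.comp (by fun_prop)).pow 2

/-- The variable `z = 1 / (1 + exp (2 a (x + y)))` in which the Pöschl–Teller equation is
hypergeometric. -/
def ptVar (a y x : ℝ) : ℝ := (1 - Real.tanh (a * (x + y))) / 2

lemma abs_ptVar_lt_one (a y x : ℝ) : |ptVar a y x| < 1 := by
  have h := abs_lt.1 (Real.abs_tanh_lt_one (a * (x + y)))
  rw [ptVar, abs_lt]
  constructor <;> linarith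

lemma four_mul_ptVar (a y x : ℝ) :
    4 * (ptVar a y x * (1 - ptVar a y x)) = 1 - Real.tanh (a * (x + y)) ^ 2 := by
  unfold ptVar
  ring

lemma hasDerivAt_ptVar (a y x : ℝ) :
    HasDerivAt (ptVar a y) (-2 * a * (ptVar a y x * (1 - ptVar a y x))) x := by
  convert! ((hasDerivAt_tanh_affine a y x).const_sub 1).div_const 2 using 1
  linear_combination -(a / 2) * four_mul_ptVar a y x

lemma tendsto_ptVar {a : ℝ} (ha : 0 < a) (y : ℝ) : Tendsto (ptVar a y) atTop (𝓝 0) := by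
  unfold ptVar
  simpa using
    ((tendsto_tanh_atTop.comp (tendsto_affine_atTop ha y)).const_sub 1).div_const 2

/-- The solution of the Pöschl–Teller equation at the energy `-κ²` asymptotic to `exp (-κ x)`
at `+∞`. -/
def ptSol (a y s κ x : ℝ) : ℝ :=
  Real.exp (-κ * x) * ₂F₁ (-s) (s + 1) (1 + κ / a) (ptVar a y x)

/-- The derivative of `ptSol`. -/
def ptSol' (a y s κ x : ℝ) : ℝ :=
  Real.exp (-κ * x) * (-κ * ₂F₁ (-s) (s + 1) (1 + κ / a) (ptVar a y x) -
    2 * a * (ptVar a y x * (1 - ptVar a y x)) *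
      ordinaryHypergeometricDeriv (-s) (s + 1) (1 + κ / a) (ptVar a y x))

section ptSol

variable {a κ : ℝ}

lemma one_le_one_add_div (ha : 0 < a) (hκ : 0 ≤ κ) : 1 ≤ 1 + κ / a :=
  le_add_of_nonneg_right (div_nonneg hκ ha.le)

lemma hasDerivAt_ptSol (ha : 0 < a) (hκ : 0 ≤ κ) (y s x : ℝ) :
    HasDerivAt (ptSol a y s κ) (ptSol' a y s κ x) x := by
  have hF := (hasDerivAt_ordinaryHypergeometric (-s) (s + 1) (one_le_one_add_div ha hκ)
    (abs_ptVar_lt_one a y x)).comp x (hasDerivAt_ptVar a y x)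
  convert! (hasDerivAt_exp_const_mul (-κ) x).mul hF using 1
  simp only [ptSol', Function.comp_apply]
  ring

lemma hasDerivAt_ptSol' (ha : 0 < a) (hκ : 0 ≤ κ) (y s x : ℝ) :
    HasDerivAt (ptSol' a y s κ) (ptCoeff a y s κ x * ptSol a y s κ x) x := by
  have hc := one_le_one_add_div ha hκ
  have hz := hasDerivAt_ptVar a y x
  have hz1 := abs_ptVar_lt_one a y x
  have hF := (hasDerivAt_ordinaryHypergeometric (-s) (s + 1) hc hz1).comp x hz
  have hF' := (hasDerivAt_ordinaryHypergeometricDeriv (-s) (s + 1) hc hz1).comp x hz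
  convert! (hasDerivAt_exp_const_mul (-κ) x).mul ((hF.const_mul (-κ)).sub
    (((hz.mul (hz.const_sub 1)).const_mul (2 * a)).mul hF')) using 1
  have ode := ordinaryHypergeometric_ode (-s) (s + 1) hc hz1
  rw [ptCoeff_eq, ← four_mul_ptVar]
  simp only [Pi.sub_apply, Pi.mul_apply, Function.comp_apply, ptSol]
  obtain ⟨k, rfl⟩ : ∃ k, κ = k * a := ⟨κ / a, (div_mul_cancel₀ κ ha.ne').symm⟩
  rw [mul_div_cancel_right₀ k ha.ne'] at ode ⊢
  linear_combination (-4 * a ^ 2 * Real.exp (-(k * a) * x) *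
    (ptVar a y x * (1 - ptVar a y x))) * ode

lemma tendsto_ordinaryHypergeometric_ptVar (ha : 0 < a) (hκ : 0 ≤ κ) (y s : ℝ) :
    Tendsto (fun x => ₂F₁ (-s) (s + 1) (1 + κ / a) (ptVar a y x)) atTop (𝓝 1) := by
  have h := (hasDerivAt_ordinaryHypergeometric (-s) (s + 1) (one_le_one_add_div ha hκ)
    (by simp : |(0 : ℝ)| < 1)).continuousAt.tendsto.comp (tendsto_ptVar ha y)
  rwa [ordinaryHypergeometric_zero] at h

lemma isDecayingSolution_ptSol (ha : 0 < a) (hκ : 0 < κ) (y s : ℝ) :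
    IsDecayingSolution (ptCoeff a y s κ) (ptSol a y s κ) (ptSol' a y s κ) where
  hasDerivAt := hasDerivAt_ptSol ha hκ.le y s
  hasDerivAt_deriv := hasDerivAt_ptSol' ha hκ.le y s
  isBigO_exp := by
    have hF := tendsto_ordinaryHypergeometric_ptVar ha hκ.le y s
    have hF' := (hasDerivAt_ordinaryHypergeometricDeriv (-s) (s + 1)
      (one_le_one_add_div ha hκ.le) (by simp : |(0 : ℝ)| < 1)).continuousAt.tendsto.comp
      (tendsto_ptVar ha y)
    have hz := tendsto_ptVar ha y
    refine ⟨κ, hκ, ?_, ?_⟩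
    · unfold ptSol
      simpa only [mul_one] using (Asymptotics.isBigO_refl _ _).mul (hF.isBigO_one ℝ)
    · unfold ptSol'
      simpa only [mul_one, Function.comp_apply] using (Asymptotics.isBigO_refl _ _).mul
        (((hF.const_mul (-κ)).sub
          (((hz.mul (hz.const_sub 1)).const_mul (2 * a)).mul hF')).isBigO_one ℝ)

lemma eventually_ptSol_pos (ha : 0 < a) (hκ : 0 ≤ κ) (y s : ℝ) :
    ∀ᶠ x in atTop, 0 < ptSol a y s κ x := by
  filter_upwards [(tendsto_ordinaryHypergeometric_ptVar ha hκ y s).eventually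
    (eventually_gt_nhds one_pos)] with x hx
  exact mul_pos (Real.exp_pos _) hx

end ptSol

/-- The solution `sinh θ / cosh ^ s θ`, `θ = a (x + y)`, of the Pöschl–Teller equation at the
threshold energy `-(a (s - 1))²`. -/
def ptXi (a y s x : ℝ) : ℝ := Real.tanh (a * (x + y)) * Real.cosh (a * (x + y)) ^ (1 - s)

/-- The derivative of `ptXi`. -/
def ptXi' (a y s x : ℝ) : ℝ :=
  a * (1 - s * Real.tanh (a * (x + y)) ^ 2) * Real.cosh (a * (x + y)) ^ (1 - s)

lemma hasDerivAt_cosh_rpow (a y p x : ℝ) :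
    HasDerivAt (fun x => Real.cosh (a * (x + y)) ^ p)
      (p * a * Real.tanh (a * (x + y)) * Real.cosh (a * (x + y)) ^ p) x := by
  have hc := Real.cosh_pos (a * (x + y))
  convert! ((((hasDerivAt_id x).add_const y).const_mul a).cosh).rpow_const (p := p)
    (Or.inl hc.ne') using 1
  simp only [id_eq]
  rw [Real.tanh_eq_sinh_div_cosh, Real.rpow_sub_one hc.ne']
  ring

lemma cosh_rpow_le {p : ℝ} (hp : p ≤ 0) (θ : ℝ) :
    Real.cosh θ ^ p ≤ 2 ^ (-p) * Real.exp (p * θ) := by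
  have h : Real.exp θ / 2 ≤ Real.cosh θ := by
    rw [Real.cosh_eq]; linarith [Real.exp_pos (-θ)]
  refine (Real.rpow_le_rpow_of_nonpos (by positivity) h hp).trans (le_of_eq ?_)
  rw [Real.div_rpow (Real.exp_pos _).le (by norm_num), ← Real.exp_mul, Real.rpow_neg (by norm_num),
    mul_comm θ p]
  field_simp

lemma isBigO_cosh_rpow {p : ℝ} (hp : p ≤ 0) (a y : ℝ) :
    (fun x => Real.cosh (a * (x + y)) ^ p) =O[atTop] fun x => Real.exp (-(-p * a) * x) := by
  refine .of_bound (2 ^ (-p) * Real.exp (p * (a * y))) (.of_forall fun x => ?_)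
  rw [Real.norm_of_nonneg (Real.rpow_nonneg (Real.cosh_pos _).le _),
    Real.norm_of_nonneg (Real.exp_pos _).le, mul_assoc, ← Real.exp_add]
  exact (cosh_rpow_le hp _).trans_eq (by ring_nf)

lemma isDecayingSolution_ptXi {a s : ℝ} (ha : 0 < a) (hs : 1 < s) (y : ℝ) :
    IsDecayingSolution (ptCoeff a y s (a * (s - 1))) (ptXi a y s) (ptXi' a y s) where
  hasDerivAt x := by
    convert! (hasDerivAt_tanh_affine a y x).mul (hasDerivAt_cosh_rpow a y (1 - s) x) using 1
    unfold ptXi'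
    ring
  hasDerivAt_deriv x := by
    convert! (((((hasDerivAt_tanh_affine a y x).pow 2).const_mul s).const_sub 1).const_mul a).mul
      (hasDerivAt_cosh_rpow a y (1 - s) x) using 1
    rw [ptCoeff_eq, ptXi]
    simp only [Pi.pow_apply]
    ring
  isBigO_exp := by
    have hw := isBigO_cosh_rpow (p := 1 - s) (by linarith) a y
    have ht := tendsto_tanh_atTop.comp (tendsto_affine_atTop ha y)
    refine ⟨-(1 - s) * a, mul_pos (by linarith) ha, ?_, ?_⟩
    · unfold ptXi
      simpa only [one_mul, Function.comp_apply] using (ht.isBigO_one ℝ).mul hw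
    · unfold ptXi'
      simpa only [one_mul, Function.comp_apply] using
        (((((ht.pow 2).const_mul s).const_sub 1).const_mul a).isBigO_one ℝ).mul hw

lemma ptXi_pos {a y x : ℝ} (ha : 0 < a) (hy : 0 < y) (s : ℝ) (hx : 0 ≤ x) : 0 < ptXi a y s x :=
  mul_pos (tanh_pos (by positivity)) (Real.rpow_pos_of_pos (Real.cosh_pos _) _)

/-- The logarithmic derivative at `0` of `ptSol`, i.e. the Weyl–Titchmarsh function of the
Pöschl–Teller equation on the half-line. -/
def ptSlope (a y s κ : ℝ) : ℝ := ptSol' a y s κ 0 / ptSol a y s κ 0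

/-- The logarithmic derivative at `0` of `ptXi`. -/
def thresholdSlope (a y s : ℝ) : ℝ := a * (1 - s * Real.tanh (a * y) ^ 2) / Real.tanh (a * y)

lemma ptXi'_div_ptXi (a y s : ℝ) :
    ptXi' a y s 0 / ptXi a y s 0 = thresholdSlope a y s := by
  have hcosh := Real.rpow_pos_of_pos (Real.cosh_pos (a * (0 + y))) (1 - s)
  rw [ptXi', ptXi, thresholdSlope, mul_div_mul_right _ _ hcosh.ne', zero_add]

section ptSlope

variable {a y s κ : ℝ} (ha : 0 < a) (hy : 0 < y) (hs : 1 < s)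

include ha hs in
lemma threshold_pos : 0 < a * (s - 1) := mul_pos ha (sub_pos.2 hs)

include ha hy hs

lemma ptSol_pos (hκ : a * (s - 1) ≤ κ) {x : ℝ} (hx : 0 ≤ x) : 0 < ptSol a y s κ x := by
  have h0 := threshold_pos ha hs
  have hκ0 : 0 < κ := h0.trans_le hκ
  have hsol := isDecayingSolution_ptSol ha hκ0 y s
  have hxi := isDecayingSolution_ptXi ha hs y
  have hev := eventually_ptSol_pos ha hκ0.le y s
  rcases hκ.eq_or_lt with rfl | hlt
  · exact hsol.pos_of_eventually_pos_of_pos hxi hev (fun _ => ptXi_pos ha hy s) hx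
  · exact hsol.pos_of_eventually_pos hxi (fun x _ => ptCoeff_lt_ptCoeff h0.le hlt a y s x) hev
      (fun _ => ptXi_pos ha hy s) hx

lemma ptSlope_threshold : ptSlope a y s (a * (s - 1)) = thresholdSlope a y s := by
  have hw := (isDecayingSolution_ptSol ha (threshold_pos ha hs) y s).wronskian_eq_zero
    (isDecayingSolution_ptXi ha hs y) 0
  rw [← ptXi'_div_ptXi, ptSlope, div_eq_div_iff (ptSol_pos ha hy hs le_rfl le_rfl).ne'
    (ptXi_pos ha hy s le_rfl).ne']
  linear_combination -hw

lemma strictAntiOn_ptSlope : StrictAntiOn (ptSlope a y s) (Set.Ici (a * (s - 1))) := by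
  intro κ hκ κ' hκ' hlt
  have hκ0 : 0 < κ := (threshold_pos ha hs).trans_le hκ
  have hcompare := (isDecayingSolution_ptSol ha (hκ0.trans hlt) y s).slope_lt
    (isDecayingSolution_ptSol ha hκ0 y s) (fun x _ => ptCoeff_lt_ptCoeff hκ0.le hlt a y s x)
    (fun x hx => ptSol_pos ha hy hs hκ' hx.le) (fun x hx => ptSol_pos ha hy hs hκ hx.le)
  rw [ptSlope, ptSlope, div_lt_div_iff₀ (ptSol_pos ha hy hs hκ' le_rfl)
    (ptSol_pos ha hy hs hκ le_rfl)]
  linarith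

lemma continuousOn_ptSlope : ContinuousOn (ptSlope a y s) (Set.Ici (a * (s - 1))) := by
  have hz := abs_ptVar_lt_one a y 0
  have hpos : ∀ κ ∈ Set.Ici (a * (s - 1)), 0 ≤ κ := fun κ hκ => (threshold_pos ha hs).le.trans hκ
  have hc : ContinuousOn (fun κ => 1 + κ / a) (Set.Ici (a * (s - 1))) := by fun_prop
  have hF := (continuousOn_ordinaryHypergeometric_param (-s) (s + 1) hz).comp hc
    fun κ hκ => one_le_one_add_div ha (hpos κ hκ)
  have hF₁ := (continuousOn_ordinaryHypergeometric_param (-s + 1) (s + 1 + 1) hz).comp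
    (hc.add_const 1) fun κ hκ => (one_le_one_add_div ha (hpos κ hκ)).trans (by simp)
  have hF' : ContinuousOn (fun κ => ordinaryHypergeometricDeriv (-s) (s + 1) (1 + κ / a)
      (ptVar a y 0)) (Set.Ici (a * (s - 1))) :=
    (continuousOn_const.div hc fun κ hκ =>
      (one_pos.trans_le (one_le_one_add_div ha (hpos κ hκ))).ne').mul hF₁
  refine ContinuousOn.div ?_ ?_ fun κ hκ => (ptSol_pos ha hy hs hκ le_rfl).ne'
  · exact (by fun_prop : Continuous fun κ : ℝ => Real.exp (-κ * 0)).continuousOn.mul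
      ((continuousOn_neg.mul hF).sub (continuousOn_const.mul hF'))
  · exact (by fun_prop : Continuous fun κ : ℝ => Real.exp (-κ * 0)).continuousOn.mul hF

lemma ptSlope_lt_neg {M : ℝ} (hM : 0 < M) (hκ : a * (s - 1) ≤ κ)
    (hMκ : a ^ 2 * (s * (s + 1)) + M ^ 2 < κ ^ 2) : ptSlope a y s κ < -M := by
  have hQ : ∀ x, M ^ 2 < ptCoeff a y s κ x := fun x => by
    have : a ^ 2 * (s * (s + 1)) / Real.cosh (a * (x + y)) ^ 2 ≤ a ^ 2 * (s * (s + 1)) :=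
      div_le_self (by positivity) (one_le_pow₀ (Real.one_le_cosh _))
    rw [ptCoeff]
    linarith
  have hcompare := (isDecayingSolution_ptSol ha ((threshold_pos ha hs).trans_le hκ) y s).slope_lt
    (isDecayingSolution_exp hM) (b := 0) (fun x _ => hQ x)
    (fun x hx => ptSol_pos ha hy hs hκ hx.le) fun x _ => Real.exp_pos _
  simp only [mul_zero, Real.exp_zero, mul_one] at hcompare
  rw [ptSlope, div_lt_iff₀ (ptSol_pos ha hy hs hκ le_rfl)]
  linarith

lemma bijOn_ptSlope :
    Set.BijOn (ptSlope a y s) (Set.Ioi (a * (s - 1))) (Set.Iio (thresholdSlope a y s)) := by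
  have anti := strictAntiOn_ptSlope ha hy hs
  refine ⟨fun κ hκ => ?_, anti.injOn.mono Set.Ioi_subset_Ici_self, fun t ht => ?_⟩
  · rw [Set.mem_Iio, ← ptSlope_threshold ha hy hs]
    exact anti Set.self_mem_Ici (Set.mem_Ici_of_Ioi hκ) hκ
  · rw [Set.mem_Iio, ← ptSlope_threshold ha hy hs] at ht
    set K := a * (s - 1) + a ^ 2 * (s * (s + 1)) + (|t| + 1)
    have h0 := threshold_pos ha hs
    have ht0 := abs_nonneg t
    have hP : 0 ≤ a ^ 2 * (s * (s + 1)) := by positivity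
    have hK : a * (s - 1) ≤ K := by linarith
    have steep : ptSlope a y s K < -(|t| + 1) :=
      ptSlope_lt_neg ha hy hs (by linarith) hK (by nlinarith)
    obtain ⟨κ, hκ, rfl⟩ := intermediate_value_Icc' hK
      ((continuousOn_ptSlope ha hy hs).mono Set.Icc_subset_Ici_self)
      ⟨by linarith [neg_abs_le t], ht.le⟩
    exact ⟨κ, hκ.1.lt_of_ne (by rintro rfl; exact lt_irrefl _ ht), rfl⟩

end ptSlope

/-! ### Weak derivatives -/

section WeakDeriv

open TopologicalSpace (Opens)
open scoped Distributions LineDeriv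

variable {E : Type*} [NormedAddCommGroup E] [NormedSpace ℝ E] {Ω Ω' : Opens ℝ}
  {f f₁ f₂ g g₁ g₂ : ℝ → E} {w w' : ℝ → ℝ}

/-- `g` is the weak derivative of `f` on the open set `Ω`. The integrals are junk unless `f` and `g`
are locally integrable on `Ω`, which is left to the lemmas below. -/
def HasWeakDerivOn (Ω : Opens ℝ) (f g : ℝ → E) : Prop :=
  ∀ φ : 𝓓(Ω, ℝ), ∫ x, deriv φ x • f x = -∫ x, φ x • g x

/-- The punctured line `ℝ ∖ {0}`. -/
def puncturedLine : Opens ℝ := ⟨{0}ᶜ, isOpen_compl_singleton⟩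

/-- The open half-line `(0, ∞)`. -/
def posHalfLine : Opens ℝ := ⟨Set.Ioi 0, isOpen_Ioi⟩

lemma hasWeakDeriv_iff {f g : ℝ → ℂ} : HasWeakDeriv f g ↔ HasWeakDerivOn puncturedLine f g :=
  ⟨fun h φ => h φ φ.contDiff φ.hasCompactSupport φ.tsupport_subset,
    fun h φ h₁ h₂ h₃ => h ⟨φ, h₁, h₂, h₃⟩⟩

lemma testFunction_eq_zero (φ : 𝓓(Ω, ℝ)) {x : ℝ} (hx : x ∉ Ω) : φ x = 0 :=
  image_eq_zero_of_notMem_tsupport fun h => hx (φ.tsupport_subset h)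

lemma hasDerivAt_testFunction (φ : 𝓓(Ω, ℝ)) (x : ℝ) : HasDerivAt φ (deriv φ x) x :=
  ((contDiff_infty_iff_deriv.1 φ.contDiff).1 x).hasDerivAt

lemma lineDerivOp_one_apply (φ : 𝓓(Ω, ℝ)) (x : ℝ) :
    (∂_{(1 : ℝ)} φ : 𝓓(Ω, ℝ)) x = deriv φ x := by
  rw [TestFunction.lineDerivOp_eq_lineDerivCLM ℝ, TestFunction.lineDerivCLM_apply_of_le (by simp),
    (hasDerivAt_testFunction φ x).differentiableAt.lineDeriv_eq_fderiv, fderiv_apply_one_eq_deriv]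

lemma deriv_testFunction_eq_zero (φ : 𝓓(Ω, ℝ)) {x : ℝ} (hx : x ∉ Ω) : deriv φ x = 0 := by
  rw [← lineDerivOp_one_apply, testFunction_eq_zero _ hx]

lemma integrable_testFunction (φ : 𝓓(Ω, ℝ)) : Integrable φ :=
  φ.continuous.integrable_of_hasCompactSupport φ.hasCompactSupport

lemma integrable_testFunction_smul (φ : 𝓓(Ω, ℝ)) (hf : LocallyIntegrableOn f Ω) :
    Integrable fun x => φ x • f x :=
  φ.integrable_bilin (ContinuousLinearMap.lsmul ℝ ℝ) hf

lemma integrable_deriv_testFunction_smul (φ : 𝓓(Ω, ℝ)) (hf : LocallyIntegrableOn f Ω) :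
    Integrable fun x => deriv φ x • f x := by
  simpa only [lineDerivOp_one_apply] using integrable_testFunction_smul (∂_{(1 : ℝ)} φ) hf

/-- The product of a test function on `Ω` with a function smooth on `Ω`, whose values outside `Ω`
do not matter. -/
def testMul (φ : 𝓓(Ω, ℝ)) (hw : ContDiffOn ℝ (⊤ : ℕ∞) w Ω) : 𝓓(Ω, ℝ) where
  toFun x := φ x * w x
  contDiff' := by
    refine contDiff_of_contDiffOn_union_of_isOpen (s := Ω) (t := (tsupport φ)ᶜ)
      (φ.contDiff.contDiffOn.mul hw) ?_ ?_ Ω.isOpen (isClosed_tsupport φ).isOpen_compl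
    · refine (contDiffOn_const (c := (0 : ℝ))).congr fun x hx => ?_
      rw [image_eq_zero_of_notMem_tsupport hx, zero_mul]
    · rw [← Set.compl_subset_iff_union, Set.compl_subset_compl]
      exact φ.tsupport_subset
  hasCompactSupport' := φ.hasCompactSupport.mul_right
  tsupport_subset' := (tsupport_mul_subset_left (f := φ) (g := w)).trans φ.tsupport_subset

namespace HasWeakDerivOn

lemma congr (h : HasWeakDerivOn Ω f g) (hf : ∀ᵐ x, x ∈ Ω → f x = f₁ x)
    (hg : ∀ᵐ x, x ∈ Ω → g x = g₁ x) : HasWeakDerivOn Ω f₁ g₁ := by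
  intro φ
  have ef : ∫ x, deriv φ x • f₁ x = ∫ x, deriv φ x • f x := by
    refine integral_congr_ae (hf.mono fun x hx => ?_)
    by_cases hΩ : x ∈ Ω
    · simp only [hx hΩ]
    · simp only [deriv_testFunction_eq_zero φ hΩ, zero_smul]
  have eg : ∫ x, φ x • g₁ x = ∫ x, φ x • g x := by
    refine integral_congr_ae (hg.mono fun x hx => ?_)
    by_cases hΩ : x ∈ Ω
    · simp only [hx hΩ]
    · simp only [testFunction_eq_zero φ hΩ, zero_smul]
  rw [ef, eg, h φ]

lemma mono (h : HasWeakDerivOn Ω f g) (hΩ : Ω' ≤ Ω) : HasWeakDerivOn Ω' f g := fun φ =>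
  h ⟨φ, φ.contDiff, φ.hasCompactSupport, φ.tsupport_subset.trans hΩ⟩

lemma comp_neg (h : HasWeakDerivOn Ω f g) (hΩ : ∀ x ∈ Ω', -x ∈ Ω) :
    HasWeakDerivOn Ω' (fun x => f (-x)) (fun x => -g (-x)) := by
  intro φ
  have hsub : tsupport (φ ∘ Neg.neg) ⊆ (Ω : Set ℝ) := fun x hx => by
    rw [← Homeomorph.coe_neg, tsupport_comp_eq_preimage] at hx
    simpa using hΩ _ (φ.tsupport_subset hx)
  have key : ∫ x, deriv (fun t => φ (-t)) x • f x = -∫ x, φ (-x) • g x :=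
    h ⟨φ ∘ Neg.neg, φ.contDiff.comp contDiff_neg,
      φ.hasCompactSupport.comp_homeomorph (Homeomorph.neg ℝ), hsub⟩
  simp only [deriv_comp_neg, neg_smul, integral_neg] at key
  rw [← integral_neg_eq_self fun x => deriv φ x • f (-x),
    ← integral_neg_eq_self fun x => φ x • -g (-x)]
  simp only [neg_neg, smul_neg, integral_neg]
  exact neg_inj.1 key

lemma sub (h₁ : HasWeakDerivOn Ω f₁ g₁) (h₂ : HasWeakDerivOn Ω f₂ g₂)
    (hf₁ : LocallyIntegrableOn f₁ Ω) (hg₁ : LocallyIntegrableOn g₁ Ω)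
    (hf₂ : LocallyIntegrableOn f₂ Ω) (hg₂ : LocallyIntegrableOn g₂ Ω) :
    HasWeakDerivOn Ω (fun x => f₁ x - f₂ x) (fun x => g₁ x - g₂ x) := by
  intro φ
  simp only [smul_sub]
  rw [integral_sub (integrable_deriv_testFunction_smul φ hf₁)
      (integrable_deriv_testFunction_smul φ hf₂),
    integral_sub (integrable_testFunction_smul φ hg₁) (integrable_testFunction_smul φ hg₂),
    h₁ φ, h₂ φ, neg_sub_neg, neg_sub]

/-- The product rule: apply the definition to the test function `φ * w`. -/
lemma smul (h : HasWeakDerivOn Ω f g) (hf : LocallyIntegrableOn f Ω)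
    (hg : LocallyIntegrableOn g Ω) (hw : ContDiffOn ℝ (⊤ : ℕ∞) w Ω)
    (hw' : ∀ x ∈ Ω, HasDerivAt w (w' x) x) :
    HasWeakDerivOn Ω (fun x => w x • f x) (fun x => w' x • f x + w x • g x) := by
  intro φ
  have hw'c : ContinuousOn w' Ω := (hw.continuousOn_deriv_of_isOpen Ω.isOpen (by simp)).congr
    fun x hx => (hw' x hx).deriv.symm
  have hwf : LocallyIntegrableOn (fun x => w x • f x) Ω :=
    hf.continuousOn_smul Ω.isOpen.isLocallyClosed hw.continuousOn
  have hw'f : LocallyIntegrableOn (fun x => w' x • f x) Ω :=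
    hf.continuousOn_smul Ω.isOpen.isLocallyClosed hw'c
  have hwg : LocallyIntegrableOn (fun x => w x • g x) Ω :=
    hg.continuousOn_smul Ω.isOpen.isLocallyClosed hw.continuousOn
  have hderiv : ∀ x, deriv (testMul φ hw) x • f x =
      deriv φ x • w x • f x + φ x • w' x • f x := fun x => by
    by_cases hx : x ∈ Ω
    · have hd : HasDerivAt (testMul φ hw) (deriv φ x * w x + φ x * w' x) x :=
        (hasDerivAt_testFunction φ x).mul (hw' x hx)
      rw [hd.deriv, add_smul, mul_smul, mul_smul]
    · simp only [deriv_testFunction_eq_zero _ hx, testFunction_eq_zero _ hx, zero_smul, add_zero]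
  have key := h (testMul φ hw)
  have hmul : ∀ x, testMul φ hw x • g x = φ x • w x • g x := fun x => mul_smul _ _ _
  simp only [hderiv, hmul] at key
  rw [integral_add (integrable_deriv_testFunction_smul φ hwf)
    (integrable_testFunction_smul φ hw'f)] at key
  simp only [smul_add]
  rw [integral_add (integrable_testFunction_smul φ hw'f) (integrable_testFunction_smul φ hwg),
    eq_sub_of_add_eq key, neg_add_rev, ← sub_eq_add_neg]

end HasWeakDerivOn

lemma hasWeakDerivOn_of_hasDerivAt (hf : ∀ x ∈ Ω, HasDerivAt f (g x) x)
    (hg : ContinuousOn g Ω) : HasWeakDerivOn Ω f g := by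
  intro φ
  have hf_loc : LocallyIntegrableOn f Ω :=
    ContinuousOn.locallyIntegrableOn (fun x hx => (hf x hx).continuousAt.continuousWithinAt)
      Ω.isOpen.measurableSet
  have hg_loc : LocallyIntegrableOn g Ω := hg.locallyIntegrableOn Ω.isOpen.measurableSet
  have hderiv : ∀ x, HasDerivAt (fun x => φ x • f x) (φ x • g x + deriv φ x • f x) x := fun x => by
    by_cases hx : x ∈ tsupport φ
    · exact (hasDerivAt_testFunction φ x).smul (hf x (φ.tsupport_subset hx))
    · have hev : (fun x => φ x • f x) =ᶠ[𝓝 x] fun _ => 0 := by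
        filter_upwards [notMem_tsupport_iff_eventuallyEq.1 hx] with z hz
        rw [hz, Pi.zero_apply, zero_smul]
      have hzero : deriv φ x = 0 :=
        image_eq_zero_of_notMem_tsupport fun h => hx (tsupport_deriv_subset h)
      rw [image_eq_zero_of_notMem_tsupport hx, hzero, zero_smul, zero_smul, add_zero]
      exact (hasDerivAt_const x 0).congr_of_eventuallyEq hev
  have hint := integral_eq_zero_of_hasDerivAt_of_integrable hderiv
    ((integrable_testFunction_smul φ hg_loc).add (integrable_deriv_testFunction_smul φ hf_loc))
    (integrable_testFunction_smul φ hf_loc)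
  rw [integral_add (integrable_testFunction_smul φ hg_loc)
    (integrable_deriv_testFunction_smul φ hf_loc)] at hint
  exact eq_neg_of_add_eq_zero_right hint

/-! ### The du Bois-Reymond lemma -/

lemma exists_tsupport_subset_Icc (hΩ : (Ω : Set ℝ).OrdConnected) (φ : 𝓓(Ω, ℝ)) :
    ∃ m R, tsupport φ ⊆ Set.Icc m R ∧ Set.Icc m R ⊆ Ω := by
  rcases (tsupport φ).eq_empty_or_nonempty with hempty | hne
  · exact ⟨1, 0, by simp [hempty], by simp⟩
  · obtain ⟨m, hm, hm_le⟩ := φ.hasCompactSupport.isCompact.exists_isLeast hne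
    obtain ⟨R, hR, hR_ge⟩ := φ.hasCompactSupport.isCompact.exists_isGreatest hne
    exact ⟨m, R, fun x hx => ⟨hm_le hx, hR_ge hx⟩,
      hΩ.out (φ.tsupport_subset hm) (φ.tsupport_subset hR)⟩

lemma exists_testFunction_deriv_eq (hΩ : (Ω : Set ℝ).OrdConnected) (φ : 𝓓(Ω, ℝ))
    (h0 : ∫ x, φ x = 0) : ∃ ψ : 𝓓(Ω, ℝ), deriv ψ = φ := by
  obtain ⟨m, R, hφ, hmR⟩ := exists_tsupport_subset_Icc hΩ φ
  let F : ℝ → ℝ := fun x => ∫ t in (m - 1)..x, φ t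
  have hF : ∀ x, HasDerivAt F (φ x) x := fun x =>
    intervalIntegral.integral_hasDerivAt_right (φ.continuous.intervalIntegrable _ _)
      φ.continuous.aestronglyMeasurable.stronglyMeasurableAtFilter φ.continuous.continuousAt
  have hF_deriv : deriv F = φ := funext fun x => (hF x).deriv
  have hsupp : Function.support F ⊆ Set.Icc m R := by
    refine Function.support_subset_iff'.2 fun x hx => ?_
    rcases lt_or_ge x m with hxm | hxm
    · refine intervalIntegral.integral_zero_ae (Eventually.of_forall fun t ht => ?_)
      refine image_eq_zero_of_notMem_tsupport fun htφ => (hφ htφ).1.not_gt ?_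
      exact ht.2.trans_lt (max_lt (sub_one_lt m) hxm)
    · have hRx : R < x := lt_of_not_ge fun hxR => hx ⟨hxm, hxR⟩
      refine (intervalIntegral.integral_eq_integral_of_support_subset fun t ht => ?_).trans h0
      have htmR := hφ (subset_tsupport φ ht)
      exact ⟨(sub_one_lt m).trans_le htmR.1, htmR.2.trans hRx.le⟩
  refine ⟨⟨F, contDiff_infty_iff_deriv.2 ⟨fun x => (hF x).differentiableAt, ?_⟩,
    .of_support_subset_isCompact isCompact_Icc hsupp,
    (closure_minimal hsupp isClosed_Icc).trans hmR⟩, hF_deriv⟩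
  rw [hF_deriv]
  exact φ.contDiff

lemma exists_testFunction_integral_eq_one (hΩ : (Ω : Set ℝ).Nonempty) :
    ∃ η : 𝓓(Ω, ℝ), ∫ x, η x = 1 := by
  obtain ⟨x₀, hx₀⟩ := hΩ
  obtain ⟨η, hη_sub, hη_comp, hη, hη_range, hη_one⟩ :=
    exists_contDiff_tsupport_subset (n := ⊤) (Ω.isOpen.mem_nhds hx₀)
  have hpos : 0 < ∫ x, η x :=
    hη.continuous.integral_pos_of_hasCompactSupport_nonneg_nonzero hη_comp
      (fun x => (hη_range ⟨x, rfl⟩).1) (x := x₀) (by simp [hη_one])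
  refine ⟨(∫ x, η x)⁻¹ • ⟨η, hη, hη_comp, hη_sub⟩, ?_⟩
  exact (integral_const_mul _ _).trans (inv_mul_cancel₀ hpos.ne')

lemma HasWeakDerivOn.integral_smul_eq (h : HasWeakDerivOn Ω f fun _ => 0)
    (hf : LocallyIntegrableOn f Ω) (hΩ : (Ω : Set ℝ).OrdConnected) {η : 𝓓(Ω, ℝ)}
    (hη : ∫ x, η x = 1) (φ : 𝓓(Ω, ℝ)) :
    ∫ x, φ x • f x = (∫ x, φ x) • ∫ x, η x • f x := by
  have hzero : ∫ x, (φ - (∫ t, φ t) • η) x = 0 := by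
    calc ∫ x, (φ x - (∫ t, φ t) * η x) = (∫ t, φ t) - (∫ t, φ t) * ∫ x, η x := by
          rw [integral_sub (integrable_testFunction φ) ((integrable_testFunction η).const_mul _),
            integral_const_mul]
      _ = 0 := by rw [hη, mul_one, sub_self]
  obtain ⟨ψ, hψ⟩ := exists_testFunction_deriv_eq hΩ _ hzero
  have hderiv : ∀ x, deriv ψ x • f x = φ x • f x - (∫ t, φ t) • η x • f x := fun x => by
    rw [hψ, smul_smul, ← sub_smul]
    rfl
  have key := h ψ
  simp only [hderiv, smul_zero, integral_zero, neg_zero] at key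
  have hint : Integrable fun x => (∫ t, φ t) • η x • f x :=
    (integrable_testFunction_smul η hf).smul (∫ t, φ t)
  rwa [integral_sub (integrable_testFunction_smul φ hf) hint, integral_smul, sub_eq_zero] at key

lemma HasWeakDerivOn.ae_eq_const [CompleteSpace E] (h : HasWeakDerivOn Ω f fun _ => 0)
    (hf : LocallyIntegrableOn f Ω) (hΩ : (Ω : Set ℝ).OrdConnected) (hne : (Ω : Set ℝ).Nonempty) :
    ∃ c, ∀ᵐ x, x ∈ Ω → f x = c := by
  obtain ⟨η, hη⟩ := exists_testFunction_integral_eq_one hne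
  set c := ∫ x, η x • f x
  have hconst : LocallyIntegrableOn (fun _ => c) (Ω : Set ℝ) :=
    (locallyIntegrable_const c).locallyIntegrableOn _
  have orthogonal : ∀ φ : 𝓓(Ω, ℝ), ∫ x, φ x • (f x - c) = 0 := fun φ => by
    simp only [smul_sub]
    rw [integral_sub (integrable_testFunction_smul φ hf) (integrable_testFunction_smul φ hconst),
      integral_smul_const, h.integral_smul_eq hf hΩ hη φ, sub_self]
  refine ⟨c, ?_⟩
  filter_upwards [Ω.isOpen.ae_eq_zero_of_integral_contDiff_smul_eq_zero (hf.sub hconst)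
    fun φ h₁ h₂ h₃ => orthogonal ⟨φ, h₁, h₂, h₃⟩] with x hx hxΩ
  exact sub_eq_zero.1 (hx hxΩ)

end WeakDeriv

/-! ### Square integrable solutions on the half-line -/

lemma locallyIntegrableOn_of_memLp_two {E : Type*} [NormedAddCommGroup E] {f : ℝ → E} {s : Set ℝ}
    (hf : MemLp f 2 (volume.restrict s)) : LocallyIntegrableOn f s :=
  locallyIntegrableOn_of_locallyIntegrable_restrict (hf.locallyIntegrable (by norm_num))

section HalfLine

variable {E : Type*} [NormedAddCommGroup E] [NormedSpace ℝ E] {Ω : TopologicalSpace.Opens ℝ}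
  {Q u v : ℝ → ℝ} {f f₁ : ℝ → E}

lemma locallyIntegrableOn_smul {w : ℝ → ℝ} (hw : Continuous w) (hf : LocallyIntegrableOn f Ω) :
    LocallyIntegrableOn (fun x => w x • f x) Ω :=
  hf.continuousOn_smul Ω.isOpen.isLocallyClosed hw.continuousOn

lemma eventually_memLp_smul {w : ℝ → ℝ} {p : ENNReal} (hw : Continuous w)
    (hw_lim : Tendsto w atTop (𝓝 0)) (hf : MemLp f p (volume.restrict (Set.Ioi 0))) :
    ∀ᶠ X in atTop, MemLp (fun x => w x • f x) p (volume.restrict (Set.Ioi X)) := by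
  have hbound : ∀ᶠ X in atTop, ∀ x ≥ X, ‖w x‖ ≤ 1 :=
    eventually_forall_ge_atTop.2 <|
      (hw_lim.eventually (Metric.closedBall_mem_nhds 0 one_pos)).mono fun x hx =>
        mem_closedBall_zero_iff.1 hx
  filter_upwards [hbound, eventually_ge_atTop 0] with X hX hX0
  have hfX := hf.mono_measure (Measure.restrict_mono (Set.Ioi_subset_Ioi hX0) le_rfl)
  refine hfX.of_le_mul (c := 1) (hw.aestronglyMeasurable.smul hfX.1) ?_
  filter_upwards [ae_restrict_mem measurableSet_Ioi] with x hx
  rw [norm_smul]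
  exact mul_le_mul_of_nonneg_right (hX x (le_of_lt hx)) (norm_nonneg _)

namespace IsDecayingSolution

lemma hasWeakDerivOn_wronskian (h : IsDecayingSolution Q u v) (hQ : ContDiff ℝ (⊤ : ℕ∞) Q)
    (hf : LocallyIntegrableOn f Ω) (hf₁ : LocallyIntegrableOn f₁ Ω) (h₁ : HasWeakDerivOn Ω f f₁)
    (h₂ : HasWeakDerivOn Ω f₁ fun x => Q x • f x) :
    HasWeakDerivOn Ω (fun x => u x • f₁ x - v x • f x) fun _ => 0 := by
  obtain ⟨hu, hv⟩ := h.contDiff hQ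
  have hQf := locallyIntegrableOn_smul hQ.continuous hf
  have huf₁ := locallyIntegrableOn_smul hu.continuous hf₁
  have hvf := locallyIntegrableOn_smul hv.continuous hf
  have hvf₁ := locallyIntegrableOn_smul hv.continuous hf₁
  have huQf := locallyIntegrableOn_smul hu.continuous hQf
  have hQuf := locallyIntegrableOn_smul (hQ.continuous.mul hu.continuous) hf
  have key := (h₂.smul hf₁ hQf hu.contDiffOn fun x _ => h.hasDerivAt x).sub
    (h₁.smul hf hf₁ hv.contDiffOn fun x _ => h.hasDerivAt_deriv x)
    huf₁ (hvf₁.add huQf) hvf (hQuf.add hvf₁)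
  refine key.congr (ae_of_all _ fun _ _ => rfl) (ae_of_all _ fun x _ => ?_)
  rw [smul_smul, mul_comm (u x)]
  abel

/-- The Wronskian of two square integrable solutions is constant, and square integrable because
`u` and `v` are bounded near `+∞`. -/
lemma ae_wronskian_eq_zero [CompleteSpace E] (h : IsDecayingSolution Q u v)
    (hQ : ContDiff ℝ (⊤ : ℕ∞) Q)
    (hf : MemLp f 2 (volume.restrict (Set.Ioi 0)))
    (hf₁ : MemLp f₁ 2 (volume.restrict (Set.Ioi 0)))
    (h₁ : HasWeakDerivOn posHalfLine f f₁)
    (h₂ : HasWeakDerivOn posHalfLine f₁ fun x => Q x • f x) :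
    ∀ᵐ x, 0 < x → u x • f₁ x = v x • f x := by
  have loc : LocallyIntegrableOn f posHalfLine := locallyIntegrableOn_of_memLp_two hf
  have loc₁ : LocallyIntegrableOn f₁ posHalfLine := locallyIntegrableOn_of_memLp_two hf₁
  obtain ⟨c, hc⟩ := (h.hasWeakDerivOn_wronskian hQ loc loc₁ h₁ h₂).ae_eq_const
    ((locallyIntegrableOn_smul h.continuous loc₁).sub
      (locallyIntegrableOn_smul h.continuous_deriv loc))
    Set.ordConnected_Ioi Set.nonempty_Ioi
  obtain ⟨X, hX, hX₁, hX0⟩ := ((eventually_memLp_smul h.continuous h.tendsto_zero.1 hf₁).and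
    ((eventually_memLp_smul h.continuous_deriv h.tendsto_zero.2 hf).and
      (eventually_ge_atTop 0))).exists
  have hcX : MemLp (fun _ : ℝ => c) 2 (volume.restrict (Set.Ioi X)) := by
    refine (hX.sub hX₁).ae_eq ?_
    filter_upwards [ae_restrict_mem measurableSet_Ioi, ae_restrict_of_ae hc] with x hx hcx
    exact hcx (hX0.trans_lt hx)
  have hc0 : c = 0 := by
    simpa [memLp_const_iff (p := 2) (by norm_num) (by norm_num)] using hcX
  filter_upwards [hc] with x hx hx0
  exact sub_eq_zero.1 ((hx hx0).trans hc0)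

/-- Reduction of order: as the Wronskian vanishes, `u⁻¹ • f` has weak derivative zero. -/
lemma exists_ae_eq_smul [CompleteSpace E] (h : IsDecayingSolution Q u v)
    (hQ : ContDiff ℝ (⊤ : ℕ∞) Q)
    (hpos : ∀ x, 0 < x → 0 < u x) (hf : MemLp f 2 (volume.restrict (Set.Ioi 0)))
    (hf₁ : MemLp f₁ 2 (volume.restrict (Set.Ioi 0)))
    (h₁ : HasWeakDerivOn posHalfLine f f₁)
    (h₂ : HasWeakDerivOn posHalfLine f₁ fun x => Q x • f x) :
    ∃ c : E, ∀ᵐ x, 0 < x → f x = u x • c ∧ f₁ x = v x • c := by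
  have hW := h.ae_wronskian_eq_zero hQ hf hf₁ h₁ h₂
  have loc : LocallyIntegrableOn f posHalfLine := locallyIntegrableOn_of_memLp_two hf
  have loc₁ : LocallyIntegrableOn f₁ posHalfLine := locallyIntegrableOn_of_memLp_two hf₁
  have hne : ∀ x ∈ Set.Ioi (0 : ℝ), u x ≠ 0 := fun x hx => (hpos x hx).ne'
  have hu_inv : ContDiffOn ℝ (⊤ : ℕ∞) (fun x => (u x)⁻¹) (Set.Ioi 0) :=
    (h.contDiff hQ).1.contDiffOn.inv hne
  have weak := (h₁.smul loc loc₁ hu_inv fun x hx =>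
    (h.hasDerivAt x).fun_inv (hne x hx)).congr (g₁ := fun _ => 0) (ae_of_all _ fun _ _ => rfl) (by
      filter_upwards [hW] with x hx hx0
      have hcancel : -v x / u x ^ 2 + (u x)⁻¹ * (u x)⁻¹ * v x = 0 := by
        field_simp
        ring
      rw [← inv_smul_smul₀ (hne x hx0) (f₁ x), hx hx0, smul_smul, smul_smul, ← add_smul, hcancel,
        zero_smul])
  obtain ⟨c, hc⟩ := weak.ae_eq_const (loc.continuousOn_smul isOpen_Ioi.isLocallyClosed
    hu_inv.continuousOn) Set.ordConnected_Ioi Set.nonempty_Ioi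
  refine ⟨c, ?_⟩
  filter_upwards [hW, hc] with x hWx hcx hx0
  have hfx : f x = u x • c := by rw [← hcx hx0, smul_inv_smul₀ (hne x hx0)]
  refine ⟨hfx, smul_right_injective E (hne x hx0) ?_⟩
  rw [hfx, smul_comm (v x)] at hWx
  exact hWx hx0

end IsDecayingSolution

end HalfLine

/-! ### Two-sided extensions -/

lemma ae_neg {p : ℝ → Prop} (h : ∀ᵐ x, p x) : ∀ᵐ x, p (-x) :=
  (Measure.measurePreserving_neg volume).quasiMeasurePreserving.ae h

lemma ae_ne_zero : ∀ᵐ x : ℝ, x ≠ 0 :=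
  compl_mem_ae_iff.2 (measure_singleton 0)

lemma neBot_nhdsWithin_inf_ae {s : Set ℝ} {x : ℝ} (hs : IsOpen s) (hx : x ∈ closure s) :
    (𝓝[s] x ⊓ ae volume).NeBot := by
  refine inf_neBot_iff_frequently_left.2 fun {p} hp => ?_
  obtain ⟨U, hU, hxU, hUs⟩ := mem_nhdsWithin.1 hp
  have hne : (U ∩ s).Nonempty := mem_closure_iff.1 hx U hU hxU
  exact (frequently_ae_mem_iff.2 ((hU.inter hs).measure_pos volume hne).ne').mono
    fun y hy => hUs hy

lemma TraceRight.unique {f : ℝ → ℂ} {a b : ℂ} (ha : TraceRight f a) (hb : TraceRight f b) :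
    a = b :=
  haveI := neBot_nhdsWithin_inf_ae (isOpen_Ioi (a := (0 : ℝ))) (x := 0) (by simp)
  tendsto_nhds_unique ha hb

lemma TraceLeft.unique {f : ℝ → ℂ} {a b : ℂ} (ha : TraceLeft f a) (hb : TraceLeft f b) : a = b :=
  haveI := neBot_nhdsWithin_inf_ae (isOpen_Iio (a := (0 : ℝ))) (x := 0) (by simp)
  tendsto_nhds_unique ha hb

lemma memLp_two_of_isBigO_exp_neg {w : ℝ → ℝ} {κ : ℝ} (hw : Continuous w) (hκ : 0 < κ)
    (h : w =O[atTop] fun x => Real.exp (-κ * x)) : MemLp w 2 (volume.restrict (Set.Ioi 0)) := by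
  refine (memLp_two_iff_integrable_sq hw.aestronglyMeasurable).2 ?_
  refine integrable_of_isBigO_exp_neg (b := 2 * κ) (by positivity) (hw.pow 2).continuousOn ?_
  refine (h.pow 2).congr_right fun x => ?_
  rw [← Real.exp_nat_mul]
  ring_nf

lemma IsDecayingSolution.memLp {Q u v : ℝ → ℝ} (h : IsDecayingSolution Q u v) :
    MemLp u 2 (volume.restrict (Set.Ioi 0)) ∧ MemLp v 2 (volume.restrict (Set.Ioi 0)) := by
  obtain ⟨κ, hκ, hu, hv⟩ := h.isBigO_exp
  exact ⟨memLp_two_of_isBigO_exp_neg h.continuous hκ hu,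
    memLp_two_of_isBigO_exp_neg h.continuous_deriv hκ hv⟩

section FoldExt

variable {E : Type*} [NormedAddCommGroup E] [NormedSpace ℝ E] {u v : ℝ → ℝ} {c d : E} {x : ℝ}

/-- The function on the line obtained from `u` on the half-line: `u` times `c` on the right and the
reflection of `u` times `d` on the left. Only the values of `u` on `[0, ∞)` matter. -/
def foldExt (u : ℝ → ℝ) (c d : E) (x : ℝ) : E := if x < 0 then u (-x) • d else u x • c

lemma foldExt_of_neg (hx : x < 0) : foldExt u c d x = u (-x) • d := if_pos hx

lemma foldExt_of_pos (hx : 0 < x) : foldExt u c d x = u x • c := if_neg hx.not_gt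

lemma foldExt_one_one (hx : x ≠ 0) : foldExt u (1 : ℂ) 1 x = (u |x| : ℂ) := by
  rcases lt_or_gt_of_ne hx with hx | hx
  · rw [foldExt_of_neg hx, abs_of_neg hx, Complex.real_smul, mul_one]
  · rw [foldExt_of_pos hx, abs_of_pos hx, Complex.real_smul, mul_one]

lemma memLp_foldExt {p : ENNReal} (hu : MemLp u p (volume.restrict (Set.Ioi 0))) (c d : E) :
    MemLp (foldExt u c d) p := by
  have hneg : MeasurePreserving Neg.neg (volume.restrict (Set.Iio (0 : ℝ)))
      (volume.restrict (Set.Ioi 0)) := by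
    simpa using (Measure.measurePreserving_neg (volume : Measure ℝ)).restrict_preimage
      (measurableSet_Ioi (a := 0))
  have hright : MemLp (fun x => u x • c) p (volume.restrict (Set.Iio 0)ᶜ) := by
    rw [Set.compl_Iio, ← restrict_Ioi_eq_restrict_Ici]
    exact ((ContinuousLinearMap.id ℝ ℝ).smulRight c).comp_memLp' hu
  classical
  have hfold : foldExt u c d = (Set.Iio 0).piecewise (fun x => u (-x) • d) fun x => u x • c := by
    funext x
    simp [foldExt, Set.piecewise]
  rw [hfold]
  exact MemLp.piecewise measurableSet_Iio
    (((ContinuousLinearMap.id ℝ ℝ).smulRight d).comp_memLp' (hu.comp_measurePreserving hneg)) hright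

lemma continuousOn_foldExt (hu : Continuous u) (c d : E) :
    ContinuousOn (foldExt u c d) {0}ᶜ := by
  intro x hx
  refine ContinuousAt.continuousWithinAt ?_
  rcases lt_or_gt_of_ne hx with hx | hx
  · exact ((hu.comp continuous_neg).smul continuous_const).continuousAt.congr
      ((eventually_lt_nhds hx).mono fun z hz => (foldExt_of_neg hz).symm)
  · exact (hu.smul continuous_const).continuousAt.congr
      ((eventually_gt_nhds hx).mono fun z hz => (foldExt_of_pos hz).symm)

lemma hasDerivAt_foldExt (hu : ∀ x, HasDerivAt u (v x) x) (c d : E) (hx : x ≠ 0) :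
    HasDerivAt (foldExt u c d) (foldExt v c (-d) x) x := by
  rcases lt_or_gt_of_ne hx with hx | hx
  · have hu_neg : HasDerivAt (fun z => u (-z)) (-v (-x)) x := by
      simpa [Function.comp_def] using (hu (-x)).scomp x (hasDerivAt_neg x)
    rw [foldExt_of_neg hx, smul_neg, ← neg_smul]
    exact (hu_neg.smul_const d).congr_of_eventuallyEq
      ((eventually_lt_nhds hx).mono fun z hz => foldExt_of_neg hz)
  · rw [foldExt_of_pos hx]
    exact ((hu x).smul_const c).congr_of_eventuallyEq
      ((eventually_gt_nhds hx).mono fun z hz => foldExt_of_pos hz)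

end FoldExt

section Trace

variable {u v : ℝ → ℝ} (c d : ℂ)

lemma hasWeakDeriv_foldExt (hu : ∀ x, HasDerivAt u (v x) x) (hv : Continuous v) :
    HasWeakDeriv (foldExt u c d) (foldExt v c (-d)) :=
  hasWeakDeriv_iff.2 <| hasWeakDerivOn_of_hasDerivAt (fun _ hx => hasDerivAt_foldExt hu c d hx)
    (continuousOn_foldExt hv c (-d))

lemma traceRight_foldExt (hu : Continuous u) : TraceRight (foldExt u c d) (u 0 • c) := by
  have h : Tendsto (fun x => u x • c) (𝓝[>] 0) (𝓝 (u 0 • c)) :=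
    (hu.smul continuous_const).continuousAt.mono_left nhdsWithin_le_nhds
  refine (h.congr' ?_).mono_left inf_le_left
  filter_upwards [self_mem_nhdsWithin] with x hx using (foldExt_of_pos hx).symm

lemma traceLeft_foldExt (hu : Continuous u) : TraceLeft (foldExt u c d) (u 0 • d) := by
  have h : Tendsto (fun x => u (-x) • d) (𝓝[<] 0) (𝓝 (u (-0) • d)) :=
    ((hu.comp continuous_neg).smul continuous_const).continuousAt.mono_left nhdsWithin_le_nhds
  rw [neg_zero] at h
  refine (h.congr' ?_).mono_left inf_le_left
  filter_upwards [self_mem_nhdsWithin] with x hx using (foldExt_of_neg hx).symm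

end Trace

/-! ### Eigenspaces of `L₁` -/

section Matching

/-- The boundary conditions `ψ'(0+) = ψ'(0-)` and `ψ(0+) - ψ(0-) = -γ ψ'(0+)` for
`ψ = foldExt u c d`, where `u(0) = u₀` and `u'(0) = v₀`. -/
def DeltaPrimeMatching (γ u₀ v₀ : ℝ) (c d : ℂ) : Prop :=
  v₀ • c = v₀ • -d ∧ u₀ • c - u₀ • d = -(γ : ℂ) * v₀ • c

variable {γ u₀ v₀ : ℝ} {c d : ℂ}

lemma deltaPrimeMatching_iff_eq (hu : u₀ ≠ 0) (hslope : v₀ / u₀ = 0) :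
    DeltaPrimeMatching γ u₀ v₀ c d ↔ d = c := by
  have hv : v₀ = 0 := (div_eq_zero_iff.1 hslope).resolve_right hu
  simp [DeltaPrimeMatching, hv, hu, sub_eq_zero, eq_comm]

lemma deltaPrimeMatching_iff_eq_neg (hγ : γ ≠ 0) (hu : u₀ ≠ 0) (hslope : v₀ / u₀ = -(2 / γ)) :
    DeltaPrimeMatching γ u₀ v₀ c d ↔ d = -c := by
  have hv : v₀ = -(2 / γ) * u₀ := (div_eq_iff hu).1 hslope
  have hv₀ : v₀ ≠ 0 := by
    rw [hv]
    exact mul_ne_zero (neg_ne_zero.2 (div_ne_zero two_ne_zero hγ)) hu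
  have hγv : (γ : ℂ) * v₀ = -(2 * u₀) := by
    exact_mod_cast (by rw [hv]; field_simp : γ * v₀ = -(2 * u₀))
  constructor
  · rintro ⟨h, -⟩
    rw [smul_right_injective ℂ hv₀ h, neg_neg]
  · rintro rfl
    refine ⟨by rw [neg_neg], ?_⟩
    simp only [Complex.real_smul]
    linear_combination c * hγv

lemma deltaPrimeMatching_iff_eq_zero (hγ : γ ≠ 0) (hu : u₀ ≠ 0)
    (hslope : v₀ / u₀ ∉ ({0, -(2 / γ)} : Set ℝ)) :
    DeltaPrimeMatching γ u₀ v₀ c d ↔ c = 0 ∧ d = 0 := by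
  simp only [Set.mem_insert_iff, Set.mem_singleton_iff, not_or] at hslope
  constructor
  · rintro ⟨h, hjump⟩
    have hcd : c = -d := smul_right_injective ℂ (fun hv => hslope.1 (by rw [hv, zero_div])) h
    have hne : (2 * u₀ + γ * v₀ : ℂ) ≠ 0 := by
      refine mod_cast fun h0 : 2 * u₀ + γ * v₀ = 0 => hslope.2 ?_
      rw [div_eq_iff hu]
      field_simp
      linear_combination h0
    have hd : d = 0 := by
      refine (mul_eq_zero.1 (?_ : (2 * u₀ + γ * v₀ : ℂ) * d = 0)).resolve_left hne
      simp only [hcd, Complex.real_smul] at hjump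
      linear_combination -hjump
    exact ⟨by rw [hcd, hd, neg_zero], hd⟩
  · rintro ⟨rfl, rfl⟩
    simp [DeltaPrimeMatching]

end Matching

namespace IsDecayingSolution

variable {Q u v : ℝ → ℝ}

lemma exists_ae_eq_foldExt {E : Type*} [NormedAddCommGroup E] [NormedSpace ℝ E] [CompleteSpace E]
    (h : IsDecayingSolution Q u v) (hQ : ContDiff ℝ (⊤ : ℕ∞) Q) (hpos : ∀ x, 0 < x → 0 < u x)
    {f f₁ f₂ : ℝ → E} (hf : MemLp f 2) (hf₁ : MemLp f₁ 2) (h₁ : HasWeakDerivOn puncturedLine f f₁)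
    (h₂ : HasWeakDerivOn puncturedLine f₁ f₂) (hf₂ : ∀ᵐ x, f₂ x = Q |x| • f x) :
    ∃ c d, f =ᵐ[volume] foldExt u c d ∧ f₁ =ᵐ[volume] foldExt v c (-d) := by
  have hneg := Measure.measurePreserving_neg (volume : Measure ℝ)
  have hne : ∀ x ∈ posHalfLine, x ∈ puncturedLine := fun x hx => ne_of_gt hx
  have hne' : ∀ x ∈ posHalfLine, -x ∈ puncturedLine := fun x hx => neg_ne_zero.2 (hne x hx)
  obtain ⟨c, hc⟩ := h.exists_ae_eq_smul hQ hpos (hf.restrict _) (hf₁.restrict _) (h₁.mono hne)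
    ((h₂.mono hne).congr (ae_of_all _ fun _ _ => rfl)
      (hf₂.mono fun x hx hx0 => by rw [hx, abs_of_pos hx0]))
  have h₂_neg : HasWeakDerivOn posHalfLine (fun x => -f₁ (-x)) fun x => f₂ (-x) := fun φ => by
    simpa only [smul_neg, integral_neg, neg_neg, neg_inj] using h₂.comp_neg hne' φ
  obtain ⟨d, hd⟩ := h.exists_ae_eq_smul hQ hpos
    ((hf.comp_measurePreserving hneg).restrict _) ((hf₁.comp_measurePreserving hneg).neg.restrict _)
    (h₁.comp_neg hne') (h₂_neg.congr (ae_of_all _ fun _ _ => rfl)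
      ((ae_neg hf₂).mono fun x hx hx0 => by rw [hx, abs_neg, abs_of_pos hx0]; rfl))
  refine ⟨c, d, ?_, ?_⟩ <;> filter_upwards [hc, ae_neg hd, ae_ne_zero] with x hcx hdx hx
  · rcases lt_or_gt_of_ne hx with hx | hx
    · simpa [foldExt_of_neg hx] using (hdx (neg_pos.2 hx)).1
    · rw [foldExt_of_pos hx, (hcx hx).1]
  · rcases lt_or_gt_of_ne hx with hx | hx
    · simpa [foldExt_of_neg hx, neg_eq_iff_eq_neg] using (hdx (neg_pos.2 hx)).2
    · rw [foldExt_of_pos hx, (hcx hx).2]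

lemma isDomainElement_toLp_foldExt (h : IsDecayingSolution Q u v) (hQ : Continuous Q) {γ : ℝ}
    {c d : ℂ} (hcd : DeltaPrimeMatching γ (u 0) (v 0) c d) {ψ₂ : L2R}
    (hψ₂ : ∀ᵐ x, ψ₂ x = Q |x| • foldExt u c d x) :
    IsDomainElement γ ((memLp_foldExt h.memLp.1 c d).toLp _)
      ((memLp_foldExt h.memLp.2 c (-d)).toLp _) ψ₂ := by
  have hu := (memLp_foldExt h.memLp.1 c d).coeFn_toLp.symm
  have hv := (memLp_foldExt h.memLp.2 c (-d)).coeFn_toLp.symm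
  have hQu : foldExt (fun x => Q x * u x) c (- -d) =ᵐ[volume] ψ₂ := by
    filter_upwards [hψ₂, ae_ne_zero] with x hx hx0
    rcases lt_or_gt_of_ne hx0 with hx0 | hx0
    · rw [hx, foldExt_of_neg hx0, foldExt_of_neg hx0, abs_of_neg hx0, neg_neg, mul_smul]
    · rw [hx, foldExt_of_pos hx0, foldExt_of_pos hx0, abs_of_pos hx0, mul_smul]
  exact ⟨(hasWeakDeriv_foldExt c d h.hasDerivAt h.continuous_deriv).congr hu hv,
    (hasWeakDeriv_foldExt c (-d) h.hasDerivAt_deriv (hQ.mul h.continuous)).congr hv hQu,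
    u 0 • c, u 0 • d, v 0 • c, Trace.congr (traceRight_foldExt c d h.continuous) hu,
    Trace.congr (traceLeft_foldExt c d h.continuous) hu,
    Trace.congr (traceRight_foldExt c (-d) h.continuous_deriv) hv,
    hcd.1 ▸ Trace.congr (traceLeft_foldExt c (-d) h.continuous_deriv) hv, hcd.2⟩

lemma exists_isDomainElement_iff (h : IsDecayingSolution Q u v) (hQ : ContDiff ℝ (⊤ : ℕ∞) Q)
    (hpos : ∀ x, 0 < x → 0 < u x) {γ : ℝ} {ψ ψ₂ : L2R} (hψ₂ : ∀ᵐ x, ψ₂ x = Q |x| • ψ x) :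
    (∃ ψ₁, IsDomainElement γ ψ ψ₁ ψ₂) ↔
      ∃ c d, ψ =ᵐ[volume] foldExt u c d ∧ DeltaPrimeMatching γ (u 0) (v 0) c d := by
  constructor
  · rintro ⟨ψ₁, hd⟩
    obtain ⟨c, d, hψ, hψ₁⟩ := h.exists_ae_eq_foldExt hQ hpos (Lp.memLp ψ) (Lp.memLp ψ₁)
      (hasWeakDeriv_iff.1 hd.weakDeriv_one) (hasWeakDeriv_iff.1 hd.weakDeriv_two) hψ₂
    obtain ⟨a, b, e, ha, hb, he, he', hjump⟩ := hd.boundary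
    obtain rfl := TraceRight.unique (Trace.congr ha hψ) (traceRight_foldExt c d h.continuous)
    obtain rfl := TraceLeft.unique (Trace.congr hb hψ) (traceLeft_foldExt c d h.continuous)
    obtain rfl := TraceRight.unique (Trace.congr he hψ₁)
      (traceRight_foldExt c (-d) h.continuous_deriv)
    exact ⟨c, d, hψ, TraceLeft.unique (Trace.congr he' hψ₁)
      (traceLeft_foldExt c (-d) h.continuous_deriv), hjump⟩
  · rintro ⟨c, d, hψ, hcd⟩
    have hψ_toLp : ψ = (memLp_foldExt h.memLp.1 c d).toLp _ :=
      Lp.ext (hψ.trans (MemLp.coeFn_toLp _).symm)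
    refine ⟨_, hψ_toLp ▸ h.isDomainElement_toLp_foldExt hQ.continuous hcd ?_⟩
    filter_upwards [hψ, hψ₂] with x hx hx₂
    rw [hx₂, hx]

end IsDecayingSolution

lemma kernel_eq_eigenspace {E : Type*} [AddCommGroup E] [Module ℂ E] (T : E →ₗ.[ℂ] E) :
    kernel T = eigenspace T 0 := by
  simp [kernel, eigenspace]

lemma mem_eigenspace_iff {E : Type*} [AddCommGroup E] [Module ℂ E] {T : E →ₗ.[ℂ] E} {z : ℂ}
    {ψ : E} : ψ ∈ eigenspace T z ↔ (ψ, z • ψ) ∈ T.graph := by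
  simp only [eigenspace, Submodule.mem_map, LinearMap.mem_ker, LinearMap.sub_apply,
    LinearMap.smul_apply, sub_eq_zero, LinearPMap.mem_graph_iff]
  refine exists_congr fun x => ⟨?_, ?_⟩
  · rintro ⟨hx, rfl⟩
    exact ⟨rfl, hx⟩
  · rintro ⟨rfl, hx⟩
    exact ⟨hx, rfl⟩

lemma mem_graph_vadd_iff {E F : Type*} [AddCommGroup E] [Module ℂ E] [AddCommGroup F] [Module ℂ F]
    {A : E →ₗ[ℂ] F} {T : E →ₗ.[ℂ] F} {ψ : E} {χ : F} :
    (ψ, χ) ∈ (A +ᵥ T).graph ↔ (ψ, χ - A ψ) ∈ T.graph := by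
  simp only [LinearPMap.mem_graph_iff]
  refine exists_congr fun x => and_congr_right ?_
  rintro rfl
  exact eq_sub_iff_add_eq'.symm

section Operator

variable {γ μ ω y κ : ℝ}

lemma mem_eigenspace_L1sym {z : ℂ} {ψ : L2R} : ψ ∈ eigenspace (L1sym γ μ ω y) z ↔
    ∃ ψ₁, IsDomainElement γ ψ ψ₁ (((ω : ℂ) - z) • ψ - mulSymPotential μ ω y ψ) := by
  have hsub : z • ψ - ((ω : ℂ) • LinearMap.id - mulSymPotential μ ω y : L2R →ₗ[ℂ] L2R) ψ =
      -(((ω : ℂ) - z) • ψ - mulSymPotential μ ω y ψ) := by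
    simp only [LinearMap.sub_apply, LinearMap.smul_apply, LinearMap.id_apply, sub_smul]
    abel
  rw [mem_eigenspace_iff, L1sym, mem_graph_vadd_iff, hamiltonian_graph, hsub]
  refine exists_congr fun ψ₁ => ⟨?_, fun h => ⟨_, h, rfl⟩⟩
  rintro ⟨ψ₂, h, hψ₂⟩
  rwa [neg_inj.1 hψ₂]

lemma sub_symPotential_eq_ptCoeff (hμ : μ ≠ 0) (hω : 0 ≤ ω) (y κ x : ℝ) :
    κ ^ 2 - symPotential μ ω y x = ptCoeff (μ * √ω) y (1 + 1 / μ) κ |x| := by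
  unfold symPotential ptCoeff
  rw [mul_pow, Real.sq_sqrt hω]
  congr 2
  field_simp
  ring

lemma coeFn_smul_sub_mulSymPotential (hμ : μ ≠ 0) (hω : 0 ≤ ω) (y κ : ℝ) (ψ : L2R) :
    ∀ᵐ x, (((ω : ℂ) - (ω - κ ^ 2 : ℝ)) • ψ - mulSymPotential μ ω y ψ : L2R) x =
      ptCoeff (μ * √ω) y (1 + 1 / μ) κ |x| • ψ x := by
  filter_upwards [Lp.coeFn_sub (((ω : ℂ) - (ω - κ ^ 2 : ℝ)) • ψ) (mulSymPotential μ ω y ψ),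
    Lp.coeFn_smul ((ω : ℂ) - (ω - κ ^ 2 : ℝ)) ψ,
    (memLp_symPotential_mul μ ω y ψ).coeFn_toLp] with x hsub hsmul hmul
  rw [← sub_symPotential_eq_ptCoeff hμ hω, hsub, Pi.sub_apply, hsmul, Pi.smul_apply,
    Complex.real_smul, smul_eq_mul]
  refine (congrArg _ hmul).trans ?_
  push_cast
  ring

section DecayingSolution

variable {u v : ℝ → ℝ} (hμ : μ ≠ 0) (hω : 0 ≤ ω)
  (h : IsDecayingSolution (ptCoeff (μ * √ω) y (1 + 1 / μ) κ) u v) (hpos : ∀ x, 0 ≤ x → 0 < u x)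
include hμ hω h hpos

lemma mem_eigenspace_L1sym_iff_foldExt {ψ : L2R} :
    ψ ∈ eigenspace (L1sym γ μ ω y) (ω - κ ^ 2 : ℝ) ↔
      ∃ c d, ψ =ᵐ[volume] foldExt u c d ∧ DeltaPrimeMatching γ (u 0) (v 0) c d := by
  rw [mem_eigenspace_L1sym]
  exact h.exists_isDomainElement_iff (contDiff_ptCoeff _ _ _ _) (fun x hx => hpos x hx.le)
    (coeFn_smul_sub_mulSymPotential hμ hω y κ ψ)

lemma eigenspace_L1sym_eq_span {σ : ℂ}
    (hσ : ∀ c d, DeltaPrimeMatching γ (u 0) (v 0) c d ↔ d = σ * c) :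
    eigenspace (L1sym γ μ ω y) (ω - κ ^ 2 : ℝ) =
      Submodule.span ℂ {(memLp_foldExt h.memLp.1 1 σ).toLp _} := by
  ext ψ
  rw [mem_eigenspace_L1sym_iff_foldExt hμ hω h hpos, Submodule.mem_span_singleton]
  refine exists_congr fun c => ?_
  have hc : c • (memLp_foldExt h.memLp.1 1 σ).toLp _ =
      (memLp_foldExt h.memLp.1 c (σ * c)).toLp (foldExt u c (σ * c)) := by
    rw [← MemLp.toLp_const_smul]
    refine MemLp.toLp_congr _ _ (ae_of_all _ fun x => ?_)
    simp only [Pi.smul_apply, foldExt, smul_eq_mul, Complex.real_smul]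
    split_ifs <;> ring
  simp only [hσ, exists_eq_right, hc]
  exact ⟨fun hψ => Lp.ext ((MemLp.coeFn_toLp _).trans hψ.symm),
    fun hψ => hψ ▸ MemLp.coeFn_toLp _⟩

lemma finrank_eigenspace_L1sym_of_matching {σ : ℂ}
    (hσ : ∀ c d, DeltaPrimeMatching γ (u 0) (v 0) c d ↔ d = σ * c) :
    Module.finrank ℂ (eigenspace (L1sym γ μ ω y) (ω - κ ^ 2 : ℝ)) = 1 := by
  rw [eigenspace_L1sym_eq_span hμ hω h hpos hσ]
  refine finrank_span_singleton fun h0 => (hpos 0 le_rfl).ne' ?_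
  have hzero : foldExt u 1 σ =ᵐ[volume] 0 :=
    (MemLp.coeFn_toLp _).symm.trans (Lp.eq_zero_iff_ae_eq_zero.1 h0)
  simpa using (TraceRight.unique (Trace.congr (f := fun _ => 0) tendsto_const_nhds hzero.symm)
    (traceRight_foldExt 1 σ h.continuous)).symm

lemma finrank_eigenspace_L1sym_eq_one (hγ : γ ≠ 0)
    (hslope : v 0 / u 0 ∈ ({0, -(2 / γ)} : Set ℝ)) :
    Module.finrank ℂ (eigenspace (L1sym γ μ ω y) (ω - κ ^ 2 : ℝ)) = 1 := by
  have hu := (hpos 0 le_rfl).ne'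
  rcases hslope with hslope | hslope
  · refine finrank_eigenspace_L1sym_of_matching hμ hω h hpos (σ := 1) fun c d => ?_
    rw [one_mul, deltaPrimeMatching_iff_eq hu hslope]
  · refine finrank_eigenspace_L1sym_of_matching hμ hω h hpos (σ := -1) fun c d => ?_
    rw [neg_one_mul, deltaPrimeMatching_iff_eq_neg hγ hu hslope]

lemma eigenspace_L1sym_eq_bot (hγ : γ ≠ 0) (hslope : v 0 / u 0 ∉ ({0, -(2 / γ)} : Set ℝ)) :
    eigenspace (L1sym γ μ ω y) (ω - κ ^ 2 : ℝ) = ⊥ := by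
  refine (Submodule.eq_bot_iff _).2 fun ψ hψ => ?_
  obtain ⟨c, d, hψ, hcd⟩ := (mem_eigenspace_L1sym_iff_foldExt hμ hω h hpos).1 hψ
  obtain ⟨rfl, rfl⟩ := (deltaPrimeMatching_iff_eq_zero hγ (hpos 0 le_rfl).ne' hslope).1 hcd
  refine Lp.eq_zero_iff_ae_eq_zero.2 (hψ.trans (ae_of_all _ fun x => ?_))
  simp [foldExt]

lemma eigenspace_L1sym_ne_bot_iff (hγ : γ ≠ 0) :
    eigenspace (L1sym γ μ ω y) (ω - κ ^ 2 : ℝ) ≠ ⊥ ↔ v 0 / u 0 ∈ ({0, -(2 / γ)} : Set ℝ) := by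
  refine ⟨not_imp_comm.1 (eigenspace_L1sym_eq_bot hμ hω h hpos hγ), fun hslope hbot => ?_⟩
  have hrank := finrank_eigenspace_L1sym_eq_one hμ hω h hpos hγ hslope
  rw [hbot, finrank_bot] at hrank
  exact zero_ne_one hrank

end DecayingSolution

end Operator

/-! ### Negative eigenvalues and kernel of `L₁` -/

section Spectrum

variable {γ μ ω y κ : ℝ}

lemma threshold_eq_sqrt (hμ : μ ≠ 0) (ω : ℝ) : μ * √ω * (1 + 1 / μ - 1) = √ω := by
  field_simp
  ring

variable (hγ : γ ≠ 0) (hμ : 0 < μ) (hω : 0 < ω) (hy : 0 < y)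
include hγ hμ hω hy

lemma finrank_eigenspace_L1sym_of_sqrt_lt (hκ : √ω < κ)
    (hslope : ptSlope (μ * √ω) y (1 + 1 / μ) κ ∈ ({0, -(2 / γ)} : Set ℝ)) :
    Module.finrank ℂ (eigenspace (L1sym γ μ ω y) (ω - κ ^ 2 : ℝ)) = 1 :=
  have ha : 0 < μ * √ω := mul_pos hμ (Real.sqrt_pos.2 hω)
  finrank_eigenspace_L1sym_eq_one hμ.ne' hω.le
    (isDecayingSolution_ptSol ha ((Real.sqrt_pos.2 hω).trans hκ) y _)
    (fun _ => ptSol_pos ha hy (by simpa using hμ) (by rw [threshold_eq_sqrt hμ.ne']; exact hκ.le))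
    hγ hslope

lemma eigenspace_L1sym_ne_bot_iff_of_sqrt_lt (hκ : √ω < κ) :
    eigenspace (L1sym γ μ ω y) (ω - κ ^ 2 : ℝ) ≠ ⊥ ↔
      ptSlope (μ * √ω) y (1 + 1 / μ) κ ∈ ({0, -(2 / γ)} : Set ℝ) :=
  have ha : 0 < μ * √ω := mul_pos hμ (Real.sqrt_pos.2 hω)
  eigenspace_L1sym_ne_bot_iff hμ.ne' hω.le
    (isDecayingSolution_ptSol ha ((Real.sqrt_pos.2 hω).trans hκ) y _)
    (fun _ => ptSol_pos ha hy (by simpa using hμ) (by rw [threshold_eq_sqrt hμ.ne']; exact hκ.le))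
    hγ

lemma negEigenvalues_L1sym_eq_image :
    negEigenvalues (L1sym γ μ ω y) = (fun κ => ω - κ ^ 2) ''
      (ptSlope (μ * √ω) y (1 + 1 / μ) ⁻¹' {0, -(2 / γ)} ∩ Set.Ioi √ω) := by
  ext ν
  constructor
  · rintro ⟨hν, hne⟩
    have hκ : √ω < √(ω - ν) := Real.sqrt_lt_sqrt hω.le (by linarith)
    have hν_eq : ω - √(ω - ν) ^ 2 = ν := by rw [Real.sq_sqrt (by linarith), sub_sub_cancel]
    rw [← hν_eq, eigenspace_L1sym_ne_bot_iff_of_sqrt_lt hγ hμ hω hy hκ] at hne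
    exact ⟨_, ⟨hne, hκ⟩, hν_eq⟩
  · rintro ⟨κ, ⟨hslope, hκ⟩, rfl⟩
    exact ⟨sub_neg.2 (Real.lt_sq_of_sqrt_lt hκ),
      (eigenspace_L1sym_ne_bot_iff_of_sqrt_lt hγ hμ hω hy hκ).2 hslope⟩

lemma finrank_eigenspace_of_mem_negEigenvalues {ν : ℝ}
    (hν : ν ∈ negEigenvalues (L1sym γ μ ω y)) :
    Module.finrank ℂ (eigenspace (L1sym γ μ ω y) ν) = 1 := by
  rw [negEigenvalues_L1sym_eq_image hγ hμ hω hy] at hν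
  obtain ⟨κ, ⟨hslope, hκ⟩, rfl⟩ := hν
  exact finrank_eigenspace_L1sym_of_sqrt_lt hγ hμ hω hy hκ hslope

lemma exists_injOn_negEigenvalues_L1sym_eq_image :
    ∃ E : ℝ → ℝ, Set.InjOn E (Set.Iio (thresholdSlope (μ * √ω) y (1 + 1 / μ))) ∧
      negEigenvalues (L1sym γ μ ω y) =
        E '' ({0, -(2 / γ)} ∩ Set.Iio (thresholdSlope (μ * √ω) y (1 + 1 / μ))) := by
  have hbij := bijOn_ptSlope (mul_pos hμ (Real.sqrt_pos.2 hω)) hy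
    (by simpa using hμ : 1 < 1 + 1 / μ)
  rw [threshold_eq_sqrt hμ.ne'] at hbij
  set κ := Function.invFunOn (ptSlope (μ * √ω) y (1 + 1 / μ)) (Set.Ioi √ω)
  have hinv := hbij.invOn_invFunOn
  have hκ := hbij.symm hinv.symm
  have hsq : Set.InjOn (fun κ => ω - κ ^ 2) (Set.Ioi √ω) := fun κ₁ h₁ κ₂ h₂ h =>
    (pow_left_inj₀ ((Real.sqrt_nonneg ω).trans (Set.mem_Ioi.1 h₁).le)
      ((Real.sqrt_nonneg ω).trans (Set.mem_Ioi.1 h₂).le) two_ne_zero).1 (sub_right_injective h)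
  refine ⟨(fun κ => ω - κ ^ 2) ∘ κ, hsq.comp hκ.injOn hκ.mapsTo, ?_⟩
  rw [Set.image_comp, hinv.2.image_inter', hκ.image_eq, negEigenvalues_L1sym_eq_image hγ hμ hω hy]

lemma exists_negEigenvalues_L1sym_eq_singleton
    (hm : -(2 / γ) < thresholdSlope (μ * √ω) y (1 + 1 / μ))
    (hm₀ : thresholdSlope (μ * √ω) y (1 + 1 / μ) ≤ 0) :
    ∃ ν : ℝ, negEigenvalues (L1sym γ μ ω y) = {ν} ∧
      Module.finrank ℂ (eigenspace (L1sym γ μ ω y) ν) = 1 := by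
  obtain ⟨E, -, hE⟩ := exists_injOn_negEigenvalues_L1sym_eq_image hγ hμ hω hy
  rw [Set.insert_inter_of_notMem (Set.notMem_Iio.2 hm₀),
    Set.inter_eq_left.2 (Set.singleton_subset_iff.2 (Set.mem_Iio.2 hm)), Set.image_singleton] at hE
  exact ⟨_, hE, finrank_eigenspace_of_mem_negEigenvalues hγ hμ hω hy (by simp [hE])⟩

lemma exists_negEigenvalues_L1sym_eq_pair
    (hm : -(2 / γ) < thresholdSlope (μ * √ω) y (1 + 1 / μ))
    (hm₀ : 0 < thresholdSlope (μ * √ω) y (1 + 1 / μ)) :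
    ∃ ν₁ ν₂ : ℝ, ν₁ ≠ ν₂ ∧ negEigenvalues (L1sym γ μ ω y) = {ν₁, ν₂} ∧
      Module.finrank ℂ (eigenspace (L1sym γ μ ω y) ν₁) = 1 ∧
      Module.finrank ℂ (eigenspace (L1sym γ μ ω y) ν₂) = 1 := by
  obtain ⟨E, hinj, hE⟩ := exists_injOn_negEigenvalues_L1sym_eq_image hγ hμ hω hy
  rw [Set.inter_eq_left.2 (Set.pair_subset (Set.mem_Iio.2 hm₀) (Set.mem_Iio.2 hm)),
    Set.image_pair] at hE
  have hne : (0 : ℝ) ≠ -(2 / γ) := (neg_ne_zero.2 (div_ne_zero two_ne_zero hγ)).symm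
  exact ⟨_, _, fun h => hne (hinj hm₀ hm h), hE,
    finrank_eigenspace_of_mem_negEigenvalues hγ hμ hω hy (by simp [hE]),
    finrank_eigenspace_of_mem_negEigenvalues hγ hμ hω hy (by simp [hE])⟩

end Spectrum

section Kernel

variable {γ μ ω y : ℝ}

lemma kernel_L1sym_eq_eigenspace (hω : 0 ≤ ω) (γ μ y : ℝ) :
    kernel (L1sym γ μ ω y) = eigenspace (L1sym γ μ ω y) (ω - √ω ^ 2 : ℝ) := by
  rw [kernel_eq_eigenspace, Real.sq_sqrt hω, sub_self, Complex.ofReal_zero]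

lemma ptXi_abs_eq_xiMinusOne (μ ω y x : ℝ) :
    ptXi (μ * √ω) y (1 + 1 / μ) |x| = xiMinusOne μ ω y x := by
  have hcosh := Real.cosh_pos (μ * √ω * (|x| + y))
  rw [ptXi, xiMinusOne, Real.rpow_sub hcosh, Real.rpow_one, Real.tanh_eq_sinh_div_cosh,
    div_mul_div_cancel₀ hcosh.ne']

lemma isDecayingSolution_ptXi_sqrt (hμ : 0 < μ) (hω : 0 < ω) (y : ℝ) :
    IsDecayingSolution (ptCoeff (μ * √ω) y (1 + 1 / μ) √ω) (ptXi (μ * √ω) y (1 + 1 / μ))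
      (ptXi' (μ * √ω) y (1 + 1 / μ)) := by
  simpa only [threshold_eq_sqrt hμ.ne'] using isDecayingSolution_ptXi
    (mul_pos hμ (Real.sqrt_pos.2 hω)) (by simpa using hμ : 1 < 1 + 1 / μ) y

variable (hμ : 0 < μ) (hω : 0 < ω) (hy : 0 < y)
include hμ hω hy

lemma ptXi_sqrt_pos (x : ℝ) (hx : 0 ≤ x) : 0 < ptXi (μ * √ω) y (1 + 1 / μ) x :=
  ptXi_pos (mul_pos hμ (Real.sqrt_pos.2 hω)) hy _ hx

lemma kernel_L1sym_eq_bot (hγ : γ ≠ 0)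
    (hm : thresholdSlope (μ * √ω) y (1 + 1 / μ) ∉ ({0, -(2 / γ)} : Set ℝ)) :
    kernel (L1sym γ μ ω y) = ⊥ := by
  rw [← ptXi'_div_ptXi] at hm
  rw [kernel_L1sym_eq_eigenspace hω.le]
  exact eigenspace_L1sym_eq_bot hμ.ne' hω.le (isDecayingSolution_ptXi_sqrt hμ hω y)
    (ptXi_sqrt_pos hμ hω hy) hγ hm

lemma finrank_kernel_L1sym_eq_one (hγ : γ ≠ 0)
    (hm : thresholdSlope (μ * √ω) y (1 + 1 / μ) ∈ ({0, -(2 / γ)} : Set ℝ)) :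
    Module.finrank ℂ (kernel (L1sym γ μ ω y)) = 1 := by
  rw [← ptXi'_div_ptXi] at hm
  rw [kernel_L1sym_eq_eigenspace hω.le]
  exact finrank_eigenspace_L1sym_eq_one hμ.ne' hω.le (isDecayingSolution_ptXi_sqrt hμ hω y)
    (ptXi_sqrt_pos hμ hω hy) hγ hm

lemma exists_kernel_L1sym_eq_span (γ : ℝ) (hm : thresholdSlope (μ * √ω) y (1 + 1 / μ) = 0) :
    ∃ ξ : L2R, (∀ᵐ x, ξ x = (xiMinusOne μ ω y x : ℂ)) ∧
      kernel (L1sym γ μ ω y) = Submodule.span ℂ {ξ} := by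
  have h := isDecayingSolution_ptXi_sqrt hμ hω y
  have hpos := ptXi_sqrt_pos hμ hω hy
  rw [← ptXi'_div_ptXi] at hm
  refine ⟨_, ?_, (kernel_L1sym_eq_eigenspace hω.le γ μ y).trans
    (eigenspace_L1sym_eq_span hμ.ne' hω.le h hpos (σ := 1) fun c d => ?_)⟩
  · filter_upwards [(memLp_foldExt h.memLp.1 (1 : ℂ) 1).coeFn_toLp, ae_ne_zero] with x hx hx₀
    rw [hx, ← ptXi_abs_eq_xiMinusOne, foldExt_one_one hx₀]
  · rw [one_mul, deltaPrimeMatching_iff_eq (hpos 0 le_rfl).ne' hm]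

end Kernel

section SymShift

variable {γ μ ω : ℝ}

lemma omegaZero_nonneg (γ : ℝ) : 0 ≤ omegaZero γ := div_nonneg (by norm_num) (sq_nonneg γ)

lemma two_div_mul_sqrt_mem_Ioo (hγ : 0 < γ) (hω : omegaZero γ < ω) :
    2 / (γ * √ω) ∈ Set.Ioo 0 1 := by
  have hω' : 2 / γ < √ω := Real.lt_sqrt_of_sq_lt <| by
    rwa [div_pow, (by norm_num : (2 : ℝ) ^ 2 = 4)]
  have hlt : 2 < γ * √ω := (div_lt_iff₀' hγ).1 hω'
  exact ⟨div_pos two_pos (two_pos.trans hlt), (div_lt_one (two_pos.trans hlt)).2 hlt⟩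

variable (hγ : 0 < γ) (hμ : 0 < μ) (hω : omegaZero γ < ω)
include hγ hμ hω

lemma mul_sqrt_mul_symShift_eq_artanh :
    μ * √ω * symShift γ μ ω = Real.artanh (2 / (γ * √ω)) := by
  have hω' : 0 < √ω := Real.sqrt_pos.2 ((omegaZero_nonneg γ).trans_lt hω)
  have hmem := two_div_mul_sqrt_mem_Ioo hγ hω
  rw [symShift, Real.artanh_eq_half_log ⟨by linarith [hmem.1], hmem.2.le⟩,
    one_add_div (by positivity), one_sub_div (by positivity),
    div_div_div_cancel_right₀ (by positivity)]
  field_simp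

lemma symShift_pos : 0 < symShift γ μ ω := by
  have hω' : 0 < √ω := Real.sqrt_pos.2 ((omegaZero_nonneg γ).trans_lt hω)
  refine pos_of_mul_pos_right (a := μ * √ω) ?_ (by positivity)
  rw [mul_sqrt_mul_symShift_eq_artanh hγ hμ hω]
  exact Real.artanh_pos (two_div_mul_sqrt_mem_Ioo hγ hω)

lemma tanh_mul_sqrt_mul_symShift : Real.tanh (μ * √ω * symShift γ μ ω) = 2 / (γ * √ω) := by
  have hmem := two_div_mul_sqrt_mem_Ioo hγ hω
  rw [mul_sqrt_mul_symShift_eq_artanh hγ hμ hω, Real.tanh_artanh ⟨by linarith [hmem.1], hmem.2⟩]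

lemma thresholdSlope_symShift :
    thresholdSlope (μ * √ω) (symShift γ μ ω) (1 + 1 / μ) = μ * γ / 2 * (ω - omegaStar γ μ) := by
  have hω₀ := (omegaZero_nonneg γ).trans_lt hω
  have : 0 < √ω := Real.sqrt_pos.2 hω₀
  have hsq : √ω ^ 2 = ω := Real.sq_sqrt hω₀.le
  rw [thresholdSlope, tanh_mul_sqrt_mul_symShift hγ hμ hω, omegaStar]
  field_simp
  rw [hsq]
  ring

lemma neg_two_div_lt_thresholdSlope_symShift :
    -(2 / γ) < thresholdSlope (μ * √ω) (symShift γ μ ω) (1 + 1 / μ) := by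
  have hdiff : μ * γ / 2 * (ω - omegaStar γ μ) + 2 / γ = μ * γ / 2 * (ω - omegaZero γ) := by
    rw [omegaStar, omegaZero]
    field_simp
    ring
  have hpos : 0 < μ * γ / 2 * (ω - omegaZero γ) := mul_pos (by positivity) (sub_pos.2 hω)
  rw [thresholdSlope_symShift hγ hμ hω]
  linarith

end SymShift

end DeltaPrime

end

open DeltaPrime in
theorem proposition6p3_general {γ μ ω y : ℝ} (hγ : γ ≠ 0) (hμ : 0 < μ) (hω : 0 < ω) (hy : 0 < y)
    (hm : -(2 / γ) < thresholdSlope (μ * √ω) y (1 + 1 / μ)) :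
    (thresholdSlope (μ * √ω) y (1 + 1 / μ) < 0 →
      kernel (L1sym γ μ ω y) = ⊥ ∧
      ∃ ν : ℝ, negEigenvalues (L1sym γ μ ω y) = {ν} ∧
        Module.finrank ℂ (eigenspace (L1sym γ μ ω y) ν) = 1) ∧
    (thresholdSlope (μ * √ω) y (1 + 1 / μ) = 0 →
      (∃ ξ : L2R, (∀ᵐ x : ℝ, ξ x = (xiMinusOne μ ω y x : ℂ)) ∧
        kernel (L1sym γ μ ω y) = Submodule.span ℂ {ξ}) ∧
      Module.finrank ℂ (kernel (L1sym γ μ ω y)) = 1 ∧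
      ∃ ν : ℝ, negEigenvalues (L1sym γ μ ω y) = {ν} ∧
        Module.finrank ℂ (eigenspace (L1sym γ μ ω y) ν) = 1) ∧
    (0 < thresholdSlope (μ * √ω) y (1 + 1 / μ) →
      kernel (L1sym γ μ ω y) = ⊥ ∧
      ∃ ν₁ ν₂ : ℝ, ν₁ ≠ ν₂ ∧ negEigenvalues (L1sym γ μ ω y) = {ν₁, ν₂} ∧
        Module.finrank ℂ (eigenspace (L1sym γ μ ω y) ν₁) = 1 ∧
        Module.finrank ℂ (eigenspace (L1sym γ μ ω y) ν₂) = 1) := by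
  have hker (hm₀ : thresholdSlope (μ * √ω) y (1 + 1 / μ) ≠ 0) : kernel (L1sym γ μ ω y) = ⊥ :=
    kernel_L1sym_eq_bot hμ hω hy hγ (not_or.2 ⟨hm₀, hm.ne'⟩)
  exact ⟨fun hneg =>
      ⟨hker hneg.ne, exists_negEigenvalues_L1sym_eq_singleton hγ hμ hω hy hm hneg.le⟩,
    fun hzero => ⟨exists_kernel_L1sym_eq_span hμ hω hy γ hzero,
      finrank_kernel_L1sym_eq_one hμ hω hy hγ (Or.inl hzero),
      exists_negEigenvalues_L1sym_eq_singleton hγ hμ hω hy hm hzero.le⟩,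
    fun hpos => ⟨hker hpos.ne', exists_negEigenvalues_L1sym_eq_pair hγ hμ hω hy hm hpos⟩⟩

open DeltaPrime in
theorem proposition6p3 (γ μ ω y : ℝ) (hγ : 0 < γ) (hμ : 0 < μ) (hω : omegaZero γ < ω)
    (hy : y = symShift γ μ ω) :
    (ω < omegaStar γ μ →
      kernel (L1sym γ μ ω y) = ⊥ ∧
      ∃ ν : ℝ, negEigenvalues (L1sym γ μ ω y) = {ν} ∧
        Module.finrank ℂ (eigenspace (L1sym γ μ ω y) ν) = 1) ∧
    (ω = omegaStar γ μ →
      (∃ ξ : L2R, (∀ᵐ x : ℝ, ξ x = (xiMinusOne μ ω y x : ℂ)) ∧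
        kernel (L1sym γ μ ω y) = Submodule.span ℂ {ξ}) ∧
      Module.finrank ℂ (kernel (L1sym γ μ ω y)) = 1 ∧
      ∃ ν : ℝ, negEigenvalues (L1sym γ μ ω y) = {ν} ∧
        Module.finrank ℂ (eigenspace (L1sym γ μ ω y) ν) = 1) ∧
    (omegaStar γ μ < ω →
      kernel (L1sym γ μ ω y) = ⊥ ∧
      ((∃ ν₁ ν₂ : ℝ, ν₁ ≠ ν₂ ∧ negEigenvalues (L1sym γ μ ω y) = {ν₁, ν₂} ∧
          Module.finrank ℂ (eigenspace (L1sym γ μ ω y) ν₁) = 1 ∧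
          Module.finrank ℂ (eigenspace (L1sym γ μ ω y) ν₂) = 1) ∨
        (∃ ν : ℝ, negEigenvalues (L1sym γ μ ω y) = {ν} ∧
          Module.finrank ℂ (eigenspace (L1sym γ μ ω y) ν) = 2))) := by
  subst hy
  have hC : 0 < μ * γ / 2 := by positivity
  obtain ⟨below, critical, above⟩ := proposition6p3_general hγ.ne' hμ
    ((omegaZero_nonneg γ).trans_lt hω) (symShift_pos hγ hμ hω)
    (neg_two_div_lt_thresholdSlope_symShift hγ hμ hω)
  rw [thresholdSlope_symShift hγ hμ hω] at below critical above
  exact ⟨fun h => below (mul_neg_of_pos_of_neg hC (sub_neg.2 h)),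
    fun h => critical (by rw [h, sub_self, mul_zero]),
    fun h => (above (mul_pos hC (sub_pos.2 h))).imp_right Or.inl⟩
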